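/- Let $d\in\{2,3\}$, let $\Omega\subset\mathbb R^d$ be open, bounded and convex, $X=\Omega\times S^{d-1}$, $\Gamma_-=\{(x,\theta)\in\partial\Omega\times S^{d-1}:\theta\cdot\nu(x)<0\}$ ($\nu$ the outward unit normal), $1\le p\le\infty$, and let $f\ge 0$ be a measurable symmetric scattering kernel on $S^{d-1}\times S^{d-1}$ with $\int_{S^{d-1}} f(\theta,\theta')\,d\theta'=1$. Put $(K\phi)(x,\theta)=\int f(\theta,\theta')\phi(x,\theta')\,d\theta'$, $(A\phi)(x)=\int_{S^{d-1}}\phi(x,\theta)\,d\theta$, $\tilde A=|S^{d-1}|^{-1}A$. Let $0<c_1\le c_2<\infty$, let $\mu_{a,xi},\mu_{s,x},\mu_{a,m},\mu_{s,m}$ and $\mu^*$ (the true fluorophore absorption coefficient $\mu_{a,xf}^*$) be measurable on $\Omega$ with values in $[c_1,c_2]$, let $\eta$ be measurable with $0\le\eta<1$, and let $q_b>0$ a.e. on $\Gamma_-$, with $q_b$ (extended to $X$ constantly along the lines of direction $\theta$) in $L^p(X)$; this holds in particular if $q_b\in L^p(\Gamma_-,|\theta\cdot\nu|)$. For a fluorophore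 absorption coefficient $\mu$, let $T_1(\mu)\in L^p(X)$ denote the solution $\phi_x$ of $$(\theta\cdot\nabla+\mu_{a,xi}+\mu+\mu_{s,x}-\mu_{s,x}K)\phi_x=0\ \text{in }X,\qquad \phi_x=q_b\ \text{on }\Gamma_-,$$ and for $\psi\in L^p(X)$ let $E(\mu,\psi)\in L^p(X)$ denote the solution $\phi_m$ of $$(\theta\cdot\nabla+\mu_{a,m}+\mu_{s,m}-\mu_{s,m}K)\phi_m=\eta\,\mu\,\tilde A\psi\ \text{in }X,\qquad \phi_m=0\ \text{on }\Gamma_-.$$ (A solution is an $L^p(X)$ function having a representative that is locally absolutely continuous along almost every line of direction $\theta$ in $\Omega$, satisfies the equation a.e. on it, and has the prescribed limit at the inflow point.) Put $\phi_x^*=T_1(\mu^*)$, $\phi_m^*=E(\mu^*,\phi_x^*)$ and $$h^*=(\mu_{a,xi}+(1-\eta)\mu^*)A\phi_x^*+\mu_{a,m}A\phi_m^*.$$ The squeeze iteration starts from $\underline\mu^0=c_1$, $\overline\mu^0=c_2$ and sets, for $i=0,1,2,\dots$, $$\underline\phi_x^i=T_1(\underline\mu^i),\quad \overline\phi_x^i=T_1(\overline\mu^i),\quad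 \overline\phi_m^i=E(\overline\mu^i,\underline\phi_x^i),\quad \underline\phi_m^i=E(\underline\mu^i,\overline\phi_x^i),$$ $$\underline\mu^{i+1}=\max\Big\{\underline\mu^i,\tfrac1{1-\eta}\Big(\tfrac{h^*-\mu_{a,m}A\overline\phi_m^i}{A\underline\phi_x^i}-\mu_{a,xi}\Big)\Big\},\qquad \overline\mu^{i+1}=\min\Big\{\overline\mu^i,\tfrac1{1-\eta}\Big(\tfrac{h^*-\mu_{a,m}A\underline\phi_m^i}{A\overline\phi_x^i}-\mu_{a,xi}\Big)\Big\}.$$ Suppose $c_1<\mu^*<c_2$ a.e. in $\Omega$. Then $\phi_x^*,\phi_m^*$ exist, the squeeze iteration can be carried out for all $i$, and for every $i\ge0$, almost everywhere, $$\underline\mu^i\le\underline\mu^{i+1}\le\mu^*<\overline\mu^{i+1}\le\overline\mu^i,$$ $$\underline\phi_x^i\ge\underline\phi_x^{i+1}\ge\phi_x^*\ge\overline\phi_x^{i+1}\ge\overline\phi_x^i,$$ $$\underline\phi_m^i\le\underline\phi_m^{i+1}\le\phi_m^*\le\overline\phi_m^{i+1}\le\overline\phi_m^i .$$ If moreover $\eta>0$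 a.e. in $\Omega$, then $\phi_m^*<\overline\phi_m^i$ a.e. in $X$ for every $i\ge 0$. -/

import Mathlib

open MeasureTheory Set Filter Topology
open scoped ENNReal

noncomputable section

namespace FPAT

/-- Euclidean space of dimension `d`. -/
abbrev Space (d : ℕ) : Type := EuclideanSpace ℝ (Fin d)

/-- Directions: the unit sphere of the Euclidean space of dimension `d`. -/
abbrev Dir (d : ℕ) : Type := Metric.sphere (0 : Space d) 1

variable {d : ℕ}

/-- Surface measure on the unit sphere. -/
def angularMeasure (d : ℕ) : Measure (Dir d) := (volume : Measure (Space d)).toSphere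

/-- The measure `dx dθ` on the phase space `X = Ω × S^{d-1}`. -/
def phaseMeasure (Ω : Set (Space d)) : Measure (Space d × Dir d) :=
  (volume.restrict Ω).prod (angularMeasure d)

/-- The scattering operator `(K φ)(x, θ) = ∫ f(θ, θ') φ(x, θ') dθ'`. -/
def scatter (f : Dir d → Dir d → ℝ) (φ : Space d × Dir d → ℝ) (z : Space d × Dir d) : ℝ :=
  ∫ θ', f z.2 θ' * φ (z.1, θ') ∂(angularMeasure d)

/-- The operator `(A φ)(x) = ∫ φ(x, θ) dθ`. -/
def angularInt (φ : Space d × Dir d → ℝ) (x : Space d) : ℝ :=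
  ∫ θ, φ (x, θ) ∂(angularMeasure d)

/-- The operator `(Ã φ)(x) = (1 / S_d) ∫ φ(x, θ) dθ`, with `S_d` the area of the unit sphere. -/
def angularMean (φ : Space d × Dir d → ℝ) (x : Space d) : ℝ :=
  ((angularMeasure d).real univ)⁻¹ * angularInt φ x

/-- A scattering kernel: measurable, nonnegative, symmetric, and a probability density in its
second variable. -/
structure IsScatteringKernel (f : Dir d → Dir d → ℝ) : Prop where
  measurable : Measurable (Function.uncurry f)
  nonneg : ∀ θ θ', 0 ≤ f θ θ'
  symm : ∀ θ θ', f θ θ' = f θ' θ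
  integral_eq_one : ∀ θ, ∫ θ', f θ θ' ∂(angularMeasure d) = 1

/-- The class `D(Ω)` of measurable coefficients with values between `c₁` and `c₂`. -/
structure IsCoeff (Ω : Set (Space d)) (c₁ c₂ : ℝ) (μ : Space d → ℝ) : Prop where
  aestronglyMeasurable : AEStronglyMeasurable μ (volume.restrict Ω)
  bounds : ∀ᵐ x ∂(volume.restrict Ω), c₁ ≤ μ x ∧ μ x ≤ c₂

/-- For `x ∈ Ω`, the distance `τ(x, θ)` from `x` to `∂Ω` in the direction `-θ`. -/
def backTime (Ω : Set (Space d)) (z : Space d × Dir d) : ℝ :=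
  sSup {t : ℝ | 0 ≤ t ∧ z.1 - t • (z.2 : Space d) ∈ Ω}

/-- For `x ∈ Ω`, the point `(x - τ(x, θ) θ, θ)` of the inflow boundary `Γ₋` at which the
characteristic line through `(x, θ)` enters `Ω`. -/
def inflowPoint (Ω : Set (Space d)) (z : Space d × Dir d) : Space d × Dir d :=
  (z.1 - backTime Ω z • (z.2 : Space d), z.2)

/-- A function on the inflow boundary, extended to the phase space constantly along the
characteristic lines.  Since
`∫_X |inflowExt Ω q_b|^p dx dθ = ∫_{Γ₋} τ₊ |q_b|^p |θ·ν| dS dθ`, where `τ₊` is the (positive,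
bounded) length of the chord that starts at the given inflow point, null sets of `Γ₋` correspond
to null sets of `X`, and the extension of every `q_b ∈ L^p(Γ₋, |θ·ν|)` is in `L^p(X)`. -/
def inflowExt (Ω : Set (Space d)) (qb : Space d × Dir d → ℝ) (z : Space d × Dir d) : ℝ :=
  qb (inflowPoint Ω z)

/-- The point `(x + t θ, θ)` on the characteristic line through `(x, θ)`. -/
def flow (z : Space d × Dir d) (t : ℝ) : Space d × Dir d :=
  (z.1 + t • (z.2 : Space d), z.2)

/-- `φ` is an `L^p` solution of the stationary radiative transfer equation
`(θ·∇ + μa + μs - μs K) φ = q` in `X`, `φ = q_b` on `Γ₋`.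
The class of `φ` has a representative `u` which, along almost every characteristic line, is
locally absolutely continuous, has directional derivative
`θ·∇u = q - (μa + μs) u + μs K u` at almost every point of the line inside `Ω`, and has limit
`q_b` at the point where the line enters `Ω`. -/
structure IsRTESolution (Ω : Set (Space d)) (f : Dir d → Dir d → ℝ) (p : ℝ≥0∞)
    (μa μs : Space d → ℝ) (q qb φ : Space d × Dir d → ℝ) : Prop where
  memLp : MemLp φ p (phaseMeasure Ω)
  exists_rep : ∃ u : Space d × Dir d → ℝ, u =ᵐ[phaseMeasure Ω] φ ∧
    ∀ᵐ z ∂(phaseMeasure Ω),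
      (∀ a b : ℝ, a ≤ b → (∀ t ∈ Icc a b, (flow z t).1 ∈ Ω) →
        AbsolutelyContinuousOnInterval (fun t => u (flow z t)) a b) ∧
      (∀ᵐ t : ℝ, (flow z t).1 ∈ Ω →
        HasDerivAt (fun s => u (flow z s))
          (q (flow z t) - (μa (flow z t).1 + μs (flow z t).1) * u (flow z t)
            + μs (flow z t).1 * scatter f u (flow z t)) t) ∧
      Tendsto (fun t => u (flow z t)) (𝓝[>] (-backTime Ω z)) (𝓝 (inflowExt Ω qb z))

/-- The known data of the problem: the domain, the scattering kernel, the coefficients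
`μ_{a,xi}`, `μ_{s,x}`, `μ_{a,m}`, `μ_{s,m}`, the quantum efficiency `η` and the boundary
source `q_b`. -/
structure Medium (d : ℕ) where
  Ω : Set (Space d)
  f : Dir d → Dir d → ℝ
  μaxi : Space d → ℝ
  μsx : Space d → ℝ
  μam : Space d → ℝ
  μsm : Space d → ℝ
  η : Space d → ℝ
  qb : Space d × Dir d → ℝ

/-- The standing assumptions on the data. -/
structure Medium.Admissible (M : Medium d) (p : ℝ≥0∞) (c₁ c₂ : ℝ) : Prop where
  isOpen : IsOpen M.Ω
  isBounded : Bornology.IsBounded M.Ω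
  convex : Convex ℝ M.Ω
  kernel : IsScatteringKernel M.f
  c₁_pos : 0 < c₁
  μaxi : IsCoeff M.Ω c₁ c₂ M.μaxi
  μsx : IsCoeff M.Ω c₁ c₂ M.μsx
  μam : IsCoeff M.Ω c₁ c₂ M.μam
  μsm : IsCoeff M.Ω c₁ c₂ M.μsm
  η_meas : AEStronglyMeasurable M.η (volume.restrict M.Ω)
  η_bounds : ∀ᵐ x ∂(volume.restrict M.Ω), 0 ≤ M.η x ∧ M.η x < 1
  qb_memLp : MemLp (inflowExt M.Ω M.qb) p (phaseMeasure M.Ω)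
  qb_pos : ∀ᵐ z ∂(phaseMeasure M.Ω), 0 < inflowExt M.Ω M.qb z

/-- `φx` solves the excitation equation with fluorophore absorption coefficient `μ`. -/
def Medium.IsExcitation (M : Medium d) (p : ℝ≥0∞) (μ : Space d → ℝ)
    (φx : Space d × Dir d → ℝ) : Prop :=
  IsRTESolution M.Ω M.f p (fun x => M.μaxi x + μ x) M.μsx (fun _ => 0) M.qb φx

/-- `φm` solves the emission equation with source `η μ (Ã φx)` and zero inflow. -/
def Medium.IsEmission (M : Medium d) (p : ℝ≥0∞) (μ : Space d → ℝ)
    (φx φm : Space d × Dir d → ℝ) : Prop :=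
  IsRTESolution M.Ω M.f p M.μam M.μsm (fun z => M.η z.1 * μ z.1 * angularMean φx z.1)
    (fun _ => 0) φm

/-- `(φx, φm)` solves the coupled system for the fluorophore absorption coefficient `μ`. -/
def Medium.IsSolution (M : Medium d) (p : ℝ≥0∞) (μ : Space d → ℝ)
    (φx φm : Space d × Dir d → ℝ) : Prop :=
  M.IsExcitation p μ φx ∧ M.IsEmission p μ φx φm

/-- The absorbed energy `h = (μ_{a,xi} + (1 - η) μ) A φx + μ_{a,m} A φm`. -/
def Medium.energy (M : Medium d) (μ : Space d → ℝ) (φx φm : Space d × Dir d → ℝ)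
    (x : Space d) : ℝ :=
  (M.μaxi x + (1 - M.η x) * μ x) * angularInt φx x + M.μam x * angularInt φm x

/-- The update `(1 / (1 - η)) ((h - μ_{a,m} A φm) / (A φx) - μ_{a,xi})`. -/
def Medium.update (M : Medium d) (h : Space d → ℝ) (φx φm : Space d × Dir d → ℝ)
    (x : Space d) : ℝ :=
  1 / (1 - M.η x) * ((h x - M.μam x * angularInt φm x) / angularInt φx x - M.μaxi x)

/-- The six sequences of the squeeze iteration (`lo` for underlined, `hi` for overlined). -/
structure Iterates (d : ℕ) where
  μlo : ℕ → Space d → ℝ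
  μhi : ℕ → Space d → ℝ
  φxlo : ℕ → Space d × Dir d → ℝ
  φxhi : ℕ → Space d × Dir d → ℝ
  φmlo : ℕ → Space d × Dir d → ℝ
  φmhi : ℕ → Space d × Dir d → ℝ

/-- The six sequences are produced by the squeeze iteration from the data `h`, started at the
constants `c₁` and `c₂` and run forever. -/
structure Medium.IsSIM (M : Medium d) (p : ℝ≥0∞) (c₁ c₂ : ℝ) (h : Space d → ℝ)
    (s : Iterates d) : Prop where
  lo_zero : ∀ᵐ x ∂(volume.restrict M.Ω), s.μlo 0 x = c₁
  hi_zero : ∀ᵐ x ∂(volume.restrict M.Ω), s.μhi 0 x = c₂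
  excitation_lo : ∀ i, M.IsExcitation p (s.μlo i) (s.φxlo i)
  excitation_hi : ∀ i, M.IsExcitation p (s.μhi i) (s.φxhi i)
  emission_hi : ∀ i, M.IsEmission p (s.μhi i) (s.φxlo i) (s.φmhi i)
  emission_lo : ∀ i, M.IsEmission p (s.μlo i) (s.φxhi i) (s.φmlo i)
  lo_succ : ∀ i, ∀ᵐ x ∂(volume.restrict M.Ω),
    s.μlo (i + 1) x = max (s.μlo i x) (M.update h (s.φxlo i) (s.φmhi i) x)
  hi_succ : ∀ i, ∀ᵐ x ∂(volume.restrict M.Ω),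
    s.μhi (i + 1) x = min (s.μhi i x) (M.update h (s.φxhi i) (s.φmlo i) x)

end FPAT

end

noncomputable section

namespace FPAT

variable {d : ℕ}

/-! ### Measure theory along characteristic lines -/

/-! Adding `C φ` to both sides, the transport equation along a characteristic line reads `u' + C u =
q + H u` with `H = (C - μa - μs) + μs K`. Duhamel's formula makes it `φ = J + L (q + H φ)`, where
`J` is the damped inflow and `L` integrates backwards along the line with weight `exp (C t)`. For
large `C` the operator `H` is positive. In every `L^p`, `1 ≤ p`, `L` has norm at most `1 / C`, since
the flow preserves `dx dθ`, and `H` has norm at most `C - a`, where `a > 0` bounds the absorption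
from below: the kernel is normalised and symmetric, so `K` preserves constants and integrals. Thus
`L H` is positive with norm at most `(C - a) / C < 1`.

Two things follow. Monotone Picard iteration yields solutions (`exists_fixedPoint_lineInt_coll`,
`exists_isRTESolution`). And there is a maximum principle (`nonneg_of_duhamel`): the negative part
`n` of a solution with nonnegative data satisfies `n ≤ L H n`, so its integral vanishes. Applied to
the difference of two solutions this gives the comparison principle `IsRTESolution.le_and_lt`, whose
strict form comes from the positive Duhamel integral.

By comparison, the excitation field decreases in `μ`, while the emission field increases in `μ` and
in the excitation field. Fed with the true fields, the update returns `μ*`; overestimating both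
fields it returns at most `μ*`, underestimating both it returns at least `μ*`. Hence brackets of
`μ*` are preserved (`IsBracket.succ`), and all the monotonicity claims follow. Strictness of the
upper bound propagates by itself: `μ* < μhi` makes `φxhi < φx*`, which makes the next upper update
exceed `μ*`. -/

instance : IsFiniteMeasure (angularMeasure d) := by
  unfold angularMeasure; infer_instance

/-- The measure `dx dθ` on the whole space of positions and directions. -/
def fullMeasure (d : ℕ) : Measure (Space d × Dir d) :=
  (volume : Measure (Space d)).prod (angularMeasure d)

instance : SFinite (fullMeasure d) := by unfold fullMeasure; infer_instance

instance (Ω : Set (Space d)) : SFinite (phaseMeasure Ω) := by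
  unfold phaseMeasure; infer_instance

theorem isFiniteMeasure_phaseMeasure {Ω : Set (Space d)} (hb : Bornology.IsBounded Ω) :
    IsFiniteMeasure (phaseMeasure Ω) := by
  have : IsFiniteMeasure ((volume : Measure (Space d)).restrict Ω) :=
    isFiniteMeasure_restrict.2 hb.measure_lt_top.ne
  unfold phaseMeasure; infer_instance

theorem phaseMeasure_eq_restrict (Ω : Set (Space d)) :
    phaseMeasure Ω = (fullMeasure d).restrict (Prod.fst ⁻¹' Ω) := by
  rw [← Set.prod_univ, fullMeasure, ← Measure.prod_restrict, Measure.restrict_univ, phaseMeasure]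

theorem phaseMeasure_absolutelyContinuous (Ω : Set (Space d)) :
    phaseMeasure Ω ≪ fullMeasure d := by
  rw [phaseMeasure_eq_restrict]
  exact Measure.absolutelyContinuous_of_le Measure.restrict_le_self

theorem ae_phaseMeasure_mem {Ω : Set (Space d)} (hΩ : MeasurableSet Ω) :
    ∀ᵐ z ∂(phaseMeasure Ω), z.1 ∈ Ω := by
  rw [phaseMeasure_eq_restrict]
  exact ae_restrict_mem (measurable_fst hΩ)

theorem ae_phaseMeasure_iff {Ω : Set (Space d)} (hΩ : MeasurableSet Ω)
    {P : Space d × Dir d → Prop} :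
    (∀ᵐ z ∂(phaseMeasure Ω), P z) ↔ ∀ᵐ z ∂(fullMeasure d), z.1 ∈ Ω → P z := by
  rw [phaseMeasure_eq_restrict, ae_restrict_iff' (measurable_fst hΩ)]
  rfl

theorem ae_phaseMeasure_of_ae {Ω : Set (Space d)} {P : Space d → Prop}
    (h : ∀ᵐ x ∂(volume.restrict Ω), P x) : ∀ᵐ z ∂(phaseMeasure Ω), P z.1 :=
  Measure.quasiMeasurePreserving_fst.ae h

theorem measurable_flow : Measurable fun p : (Space d × Dir d) × ℝ => flow p.1 p.2 := by
  unfold flow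
  fun_prop

theorem measurable_flow_right (z : Space d × Dir d) : Measurable (flow z) :=
  measurable_flow.comp measurable_prodMk_left

theorem flow_flow (z : Space d × Dir d) (s t : ℝ) : flow (flow z s) t = flow z (s + t) := by
  simp [flow, add_smul, add_assoc]

@[simp] theorem flow_zero (z : Space d × Dir d) : flow z 0 = z := by simp [flow]

/-- For each fixed direction the flow is a translation of the position. With the direction as first
factor it is a skew product, and translation invariance of Lebesgue measure applies fibrewise. -/
theorem measurePreserving_flow (t : ℝ) :
    MeasurePreserving (fun z : Space d × Dir d => flow z t) (fullMeasure d) (fullMeasure d) := by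
  have h : MeasurePreserving (fun q : Dir d × Space d => (id q.1, q.2 + t • (q.1 : Space d)))
      ((angularMeasure d).prod volume) ((angularMeasure d).prod volume) := by
    refine MeasurePreserving.skew_product (μa := angularMeasure d) (μc := volume)
      (g := fun (θ : Dir d) (x : Space d) => x + t • (θ : Space d)) (MeasurePreserving.id _) ?_ ?_
    · unfold Function.uncurry; fun_prop
    · exact ae_of_all _ fun θ => (measurePreserving_add_right volume (t • (θ : Space d))).map_eq
  have hs : MeasurePreserving Prod.swap (fullMeasure d) ((angularMeasure d).prod volume) :=
    Measure.measurePreserving_swap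
  have hs' : MeasurePreserving Prod.swap ((angularMeasure d).prod volume) (fullMeasure d) :=
    Measure.measurePreserving_swap
  exact (hs'.comp h).comp hs

/-- Every time slice preserves the measure, so by Tonelli a null set of phase space pulls back to a
null set of pairs (point, time). This is what allows almost everywhere statements to be read along
lines. -/
theorem quasiMeasurePreserving_flow :
    Measure.QuasiMeasurePreserving (fun p : (Space d × Dir d) × ℝ => flow p.1 p.2)
      ((fullMeasure d).prod volume) (fullMeasure d) :=
  QuasiMeasurePreserving.prod_of_left measurable_flow
    (ae_of_all _ fun t => (measurePreserving_flow t).quasiMeasurePreserving)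

/-- A property that holds almost everywhere holds at almost every point of almost every line. -/
theorem ae_ae_flow {P : Space d × Dir d → Prop} (h : ∀ᵐ z ∂(fullMeasure d), P z) :
    ∀ᵐ z ∂(fullMeasure d), ∀ᵐ t : ℝ, P (flow z t) :=
  Measure.ae_ae_of_ae_prod (quasiMeasurePreserving_flow.ae h)

theorem ae_ae_flow_mem {Ω : Set (Space d)} (hΩ : MeasurableSet Ω) {P : Space d × Dir d → Prop}
    (h : ∀ᵐ z ∂(phaseMeasure Ω), P z) :
    ∀ᵐ z ∂(fullMeasure d), ∀ᵐ t : ℝ, (flow z t).1 ∈ Ω → P (flow z t) :=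
  ae_ae_flow ((ae_phaseMeasure_iff hΩ).1 h)

theorem ae_phaseMeasure_of_full {Ω : Set (Space d)} {P : Space d × Dir d → Prop}
    (h : ∀ᵐ z ∂(fullMeasure d), P z) : ∀ᵐ z ∂(phaseMeasure Ω), P z :=
  (phaseMeasure_absolutelyContinuous Ω).ae_le h

theorem lintegral_phaseMeasure_eq_indicator {Ω : Set (Space d)} (hΩ : MeasurableSet Ω)
    (g : Space d × Dir d → ℝ≥0∞) :
    ∫⁻ z, (Prod.fst ⁻¹' Ω).indicator g z ∂(fullMeasure d) = ∫⁻ z, g z ∂(phaseMeasure Ω) := by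
  rw [lintegral_indicator (measurable_fst hΩ), phaseMeasure_eq_restrict]

theorem aemeasurable_indicator_phase {Ω : Set (Space d)} (hΩ : MeasurableSet Ω)
    {g : Space d × Dir d → ℝ≥0∞} (hg : AEMeasurable g (phaseMeasure Ω)) :
    AEMeasurable ((Prod.fst ⁻¹' Ω).indicator g) (fullMeasure d) := by
  rw [aemeasurable_indicator_iff (measurable_fst hΩ), ← phaseMeasure_eq_restrict]
  exact hg

/-- The damped integral of `g` over the part of the characteristic line in `Ω` that precedes a
given point. -/
def lineInt (C : ℝ) (Ω : Set (Space d)) (g : Space d × Dir d → ℝ≥0∞) (z : Space d × Dir d) :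
    ℝ≥0∞ :=
  ∫⁻ t in Iio 0, ENNReal.ofReal (Real.exp (C * t)) * (Prod.fst ⁻¹' Ω).indicator g (flow z t)

theorem lintegral_exp_Iio {C : ℝ} (hC : 0 < C) :
    ∫⁻ t in Iio (0 : ℝ), ENNReal.ofReal (Real.exp (C * t)) = (ENNReal.ofReal C)⁻¹ := by
  rw [← Measure.restrict_congr_set Iio_ae_eq_Iic.symm,
    ← ofReal_integral_eq_lintegral_ofReal (integrableOn_exp_mul_Iic hC 0)
      (ae_of_all _ fun t => (Real.exp_pos _).le), integral_exp_mul_Iic hC]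
  rw [mul_zero, Real.exp_zero, one_div, ENNReal.ofReal_inv_of_pos hC]

/-- Tonelli: at each time the flow preserves `fullMeasure`, so the space integral does not depend on
`t` and only the integral of `exp (C t)` over the negative half-line remains. The indicator in
`lineInt` is there so that the invariance of the whole space can be used. -/
theorem lintegral_lineInt {C : ℝ} (hC : 0 < C) {Ω : Set (Space d)} (hΩ : MeasurableSet Ω)
    {g : Space d × Dir d → ℝ≥0∞} (hg : AEMeasurable g (phaseMeasure Ω)) :
    ∫⁻ z, lineInt C Ω g z ∂(fullMeasure d)
      = (ENNReal.ofReal C)⁻¹ * ∫⁻ z, g z ∂(phaseMeasure Ω) := by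
  have hg1 := aemeasurable_indicator_phase hΩ hg
  have hm : AEMeasurable (Function.uncurry fun (z : Space d × Dir d) (t : ℝ) =>
      ENNReal.ofReal (Real.exp (C * t)) * (Prod.fst ⁻¹' Ω).indicator g (flow z t))
      ((fullMeasure d).prod (volume.restrict (Iio 0))) := by
    refine AEMeasurable.mul (by fun_prop) ?_
    have h2 := hg1.comp_quasiMeasurePreserving quasiMeasurePreserving_flow
    refine h2.mono_ac ?_
    exact Measure.AbsolutelyContinuous.prod .rfl Measure.restrict_le_self.absolutelyContinuous
  unfold lineInt
  rw [lintegral_lintegral_swap hm]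
  have : ∀ t : ℝ, ∫⁻ z, ENNReal.ofReal (Real.exp (C * t))
        * (Prod.fst ⁻¹' Ω).indicator g (flow z t) ∂(fullMeasure d)
      = ENNReal.ofReal (Real.exp (C * t)) * ∫⁻ z, g z ∂(phaseMeasure Ω) := fun t => by
    rw [lintegral_const_mul' _ _ ENNReal.ofReal_ne_top,
      ← lintegral_phaseMeasure_eq_indicator hΩ]
    congr 1
    have h3 := (measurePreserving_flow (d := d) t)
    rw [← h3.map_eq] at hg1
    rw [← lintegral_map' hg1 h3.measurable.aemeasurable, h3.map_eq]
  simp_rw [this]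
  rw [lintegral_mul_const _ (by fun_prop), lintegral_exp_Iio hC]

theorem lintegral_lineInt_le {C : ℝ} (hC : 0 < C) {Ω : Set (Space d)} (hΩ : MeasurableSet Ω)
    {g : Space d × Dir d → ℝ≥0∞} (hg : AEMeasurable g (phaseMeasure Ω)) :
    ENNReal.ofReal C * ∫⁻ z, lineInt C Ω g z ∂(phaseMeasure Ω) ≤ ∫⁻ z, g z ∂(phaseMeasure Ω) := by
  calc ENNReal.ofReal C * ∫⁻ z, lineInt C Ω g z ∂(phaseMeasure Ω)
      ≤ ENNReal.ofReal C * ∫⁻ z, lineInt C Ω g z ∂(fullMeasure d) := by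
        rw [phaseMeasure_eq_restrict]
        gcongr
        exact Measure.restrict_le_self
    _ = ∫⁻ z, g z ∂(phaseMeasure Ω) := by
        rw [lintegral_lineInt hC hΩ hg, ← mul_assoc,
          ENNReal.mul_inv_cancel (by simpa using hC) ENNReal.ofReal_ne_top, one_mul]

theorem measurable_lineInt {C : ℝ} {Ω : Set (Space d)} (hΩ : MeasurableSet Ω)
    {g : Space d × Dir d → ℝ≥0∞} (hg : Measurable g) : Measurable (lineInt C Ω g) := by
  unfold lineInt
  refine Measurable.lintegral_prod_right' (f := fun p : (Space d × Dir d) × ℝ =>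
      ENNReal.ofReal (Real.exp (C * p.2)) * (Prod.fst ⁻¹' Ω).indicator g (flow p.1 p.2)) ?_
  exact Measurable.mul (by fun_prop)
    ((hg.indicator (measurable_fst hΩ)).comp measurable_flow)

theorem lineInt_mono {C : ℝ} {Ω : Set (Space d)} {g h : Space d × Dir d → ℝ≥0∞} (hgh : g ≤ h) :
    lineInt C Ω g ≤ lineInt C Ω h := fun z => by
  unfold lineInt
  gcongr
  exact hgh _

theorem lineInt_const_mul {C : ℝ} {Ω : Set (Space d)} (g : Space d × Dir d → ℝ≥0∞)
    {c : ℝ≥0∞} (hc : c ≠ ∞) (z : Space d × Dir d) :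
    lineInt C Ω (fun y => c * g y) z = c * lineInt C Ω g z := by
  unfold lineInt
  rw [← lintegral_const_mul' _ _ hc]
  congr with t
  rw [Set.indicator_const_mul]
  ring

theorem lineInt_add_const_le {C : ℝ} (hC : 0 < C) {Ω : Set (Space d)}
    (g : Space d × Dir d → ℝ≥0∞) (c : ℝ≥0∞) (z : Space d × Dir d) :
    lineInt C Ω (fun y => g y + c) z ≤ lineInt C Ω g z + (ENNReal.ofReal C)⁻¹ * c := by
  unfold lineInt
  calc _ ≤ ∫⁻ t in Iio (0 : ℝ), (ENNReal.ofReal (Real.exp (C * t))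
        * (Prod.fst ⁻¹' Ω).indicator g (flow z t) + ENNReal.ofReal (Real.exp (C * t)) * c) := by
        refine lintegral_mono fun t => ?_
        rw [← mul_add]
        gcongr
        by_cases h : flow z t ∈ (Prod.fst ⁻¹' Ω : Set (Space d × Dir d)) <;> simp [h]
    _ = _ := by
      rw [lintegral_add_right _ (by fun_prop), lintegral_mul_const _ (by fun_prop),
        lintegral_exp_Iio hC]

theorem lineInt_iSup {C : ℝ} {Ω : Set (Space d)} (hΩ : MeasurableSet Ω)
    {g : ℕ → Space d × Dir d → ℝ≥0∞} (hg : ∀ n, Measurable (g n)) (hmono : Monotone g)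
    (z : Space d × Dir d) :
    lineInt C Ω (fun y => ⨆ n, g n y) z = ⨆ n, lineInt C Ω (g n) z := by
  unfold lineInt
  rw [← lintegral_iSup]
  · congr with t
    rw [← ENNReal.mul_iSup]
    congr 1
    by_cases h : flow z t ∈ (Prod.fst ⁻¹' Ω : Set (Space d × Dir d)) <;> simp [h]
  · intro n
    exact Measurable.mul (by fun_prop)
      (((hg n).indicator (measurable_fst hΩ)).comp (measurable_flow_right z))
  · intro m n hmn t
    dsimp only
    gcongr
    exact hmono hmn _

/-- Integrable functions on the phase space are locally integrable along almost every line. -/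
theorem ae_lintegral_flow_lt_top {Ω : Set (Space d)} (hΩ : MeasurableSet Ω)
    {g : Space d × Dir d → ℝ≥0∞} (hg : AEMeasurable g (phaseMeasure Ω))
    (hfin : ∫⁻ z, g z ∂(phaseMeasure Ω) ≠ ∞) :
    ∀ᵐ z ∂(fullMeasure d), ∀ n : ℕ,
      ∫⁻ t in Icc (-n : ℝ) n, (Prod.fst ⁻¹' Ω).indicator g (flow z t) < ∞ := by
  have h1 : ∀ᵐ z ∂(fullMeasure d), lineInt 1 Ω g z < ∞ := by
    have hm : AEMeasurable (lineInt 1 Ω g) (fullMeasure d) := by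
      unfold lineInt
      refine AEMeasurable.lintegral_prod_right' (f := fun p : (Space d × Dir d) × ℝ =>
        ENNReal.ofReal (Real.exp (1 * p.2)) * (Prod.fst ⁻¹' Ω).indicator g (flow p.1 p.2)) ?_
      refine AEMeasurable.mul (by fun_prop) ?_
      have h2 := (aemeasurable_indicator_phase hΩ hg).comp_quasiMeasurePreserving
        quasiMeasurePreserving_flow
      refine h2.mono_ac ?_
      exact Measure.AbsolutelyContinuous.prod .rfl Measure.restrict_le_self.absolutelyContinuous
    refine ae_lt_top' hm ?_
    rw [lintegral_lineInt one_pos hΩ hg]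
    exact ENNReal.mul_ne_top (by simp) hfin
  -- `lineInt` only looks backwards, so it is evaluated at a point further along the line. Seen from
  -- time `n + 1`, the weight on `[-n, n]` is at least `exp (-(2 n + 1))`.
  have h2 : ∀ᵐ z ∂(fullMeasure d), ∀ n : ℕ, lineInt 1 Ω g (flow z (n + 1)) < ∞ :=
    ae_all_iff.2 fun n => (measurePreserving_flow _).quasiMeasurePreserving.ae h1
  filter_upwards [h2] with z hz n
  have h3 := hz n
  unfold lineInt at h3
  simp_rw [flow_flow] at h3
  set F : ℝ → ℝ≥0∞ := fun t => (Prod.fst ⁻¹' Ω).indicator g (flow z t) with hF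
  have h4 : ∫⁻ t in Iio (n + 1 : ℝ), ENNReal.ofReal (Real.exp (1 * (t - (n + 1)))) * F t < ∞ := by
    have := (measurePreserving_add_left (volume : Measure ℝ) (n + 1 : ℝ)).setLIntegral_comp_emb
      (MeasurableEquiv.addLeft (n + 1 : ℝ)).measurableEmbedding
      (fun t => ENNReal.ofReal (Real.exp (1 * (t - (n + 1)))) * F t) (Iio 0)
    simp only [add_sub_cancel_left, image_const_add_Iio, add_zero] at this
    rw [← this]
    exact h3
  have h5 : ENNReal.ofReal (Real.exp (-(2 * n + 1))) * ∫⁻ t in Icc (-n : ℝ) n, F t < ∞ := by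
    refine lt_of_le_of_lt ?_ h4
    rw [← lintegral_const_mul' _ _ ENNReal.ofReal_ne_top]
    calc _ ≤ ∫⁻ t in Icc (-n : ℝ) n, ENNReal.ofReal (Real.exp (1 * (t - (n + 1)))) * F t := by
          refine setLIntegral_mono' measurableSet_Icc fun t ht => ?_
          gcongr
          linarith [ht.1]
      _ ≤ _ := lintegral_mono_set fun t ht => by
          have := ht.2
          simp only [mem_Iio]; linarith
  have h6 : ENNReal.ofReal (Real.exp (-(2 * n + 1))) ≠ 0 := by
    simpa using Real.exp_pos _
  by_contra hcon
  rw [not_lt, top_le_iff] at hcon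
  rw [hcon, ENNReal.mul_top h6] at h5
  exact lt_irrefl _ h5

/-! ### Sub-Markovian operators -/

/-- A positive homogeneous operator on nonnegative functions that does not increase constants
or integrals. -/
structure IsSubMarkov {α : Type*} [MeasurableSpace α] (m : Measure α)
    (P : (α → ℝ≥0∞) → α → ℝ≥0∞) : Prop where
  measurable : ∀ g, Measurable g → Measurable (P g)
  mono : ∀ g h, g ≤ h → P g ≤ P h
  const_mul : ∀ c : ℝ≥0∞, c ≠ ∞ → ∀ g z, P (fun y => c * g y) z = c * P g z
  add_const : ∀ g, Measurable g → ∀ c z, P (fun y => g y + c) z ≤ P g z + c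
  lintegral_le : ∀ g, Measurable g → ∫⁻ z, P g z ∂m ≤ ∫⁻ z, g z ∂m

/-- Young's inequality with exponents `r` and `r / (r - 1)`: the graph of the convex function `x ^
r` lies above its tangent at `b`, here written without subtraction. -/
theorem ennreal_tangent_le {r : ℝ} (hr : 1 < r) (x b : ℝ≥0∞) :
    ENNReal.ofReal r * b ^ (r - 1) * x ≤ x ^ r + ENNReal.ofReal (r - 1) * b ^ r := by
  have hc : r.HolderConjugate (r / (r - 1)) := Real.HolderConjugate.conjExponent hr
  have h := ENNReal.young_inequality x (b ^ (r - 1)) hc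
  have hr0 : 0 < r := by linarith
  have hr1 : 0 < r - 1 := by linarith
  have e1 : (b ^ (r - 1)) ^ (r / (r - 1)) = b ^ r := by
    rw [← ENNReal.rpow_mul]
    congr 1
    field_simp
  rw [e1] at h
  have hne : ENNReal.ofReal r ≠ 0 := by simpa using hr0
  calc ENNReal.ofReal r * b ^ (r - 1) * x = ENNReal.ofReal r * (x * b ^ (r - 1)) := by ring
    _ ≤ ENNReal.ofReal r * (x ^ r / ENNReal.ofReal r + b ^ r / ENNReal.ofReal (r / (r - 1))) := by
        gcongr
    _ = x ^ r + ENNReal.ofReal (r - 1) * b ^ r := by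
        rw [mul_add, ENNReal.mul_div_cancel hne ENNReal.ofReal_ne_top]
        congr 1
        rw [ENNReal.ofReal_div_of_pos hr1, div_eq_mul_inv,
          ENNReal.inv_div (Or.inl ENNReal.ofReal_ne_top) (Or.inl (by simpa using hr1)),
          mul_comm (b ^ r), ← mul_assoc, ENNReal.mul_div_cancel hne ENNReal.ofReal_ne_top]

/-- A convex function is the supremum of its tangents. The tangent at `b = a` suffices for finite
`a`; for `a = ∞` the tangent at `1` already forces `c = ∞`. -/
theorem ennreal_rpow_le_of_tangent_le {r : ℝ} (hr : 1 < r) {a c : ℝ≥0∞}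
    (h : ∀ b : ℝ≥0∞, b ≠ ∞ →
      ENNReal.ofReal r * b ^ (r - 1) * a ≤ c + ENNReal.ofReal (r - 1) * b ^ r) :
    a ^ r ≤ c := by
  have hr0 : 0 < r := by linarith
  by_cases ha : a = ∞
  · have h1 := h 1 ENNReal.one_ne_top
    rw [ha] at h1
    simp only [ENNReal.one_rpow, mul_one] at h1
    rw [ENNReal.mul_top (by simpa using hr0), top_le_iff, ENNReal.add_eq_top] at h1
    rcases h1 with h1 | h1
    · simp [h1]
    · exact absurd h1 ENNReal.ofReal_ne_top
  · have h1 := h a ha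
    have e : a ^ (r - 1) * a = a ^ r := by
      conv_rhs => rw [show r = (r - 1) + 1 by ring]
      rw [ENNReal.rpow_add_of_nonneg _ _ (by linarith) zero_le_one, ENNReal.rpow_one]
    rw [mul_assoc, e, show ENNReal.ofReal r = 1 + ENNReal.ofReal (r - 1) by
      rw [← ENNReal.ofReal_one, ← ENNReal.ofReal_add zero_le_one (by linarith)]; congr 1; ring,
      add_mul, one_mul] at h1
    refine (ENNReal.add_le_add_iff_right ?_).1 h1
    exact ENNReal.mul_ne_top ENNReal.ofReal_ne_top (ENNReal.rpow_ne_top_of_nonneg hr0.le ha)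

/-- Jensen's inequality: `P` is applied to the tangent inequality at a fixed `b`, the constant term
passes through `P` without growing, and then `b` is optimised at the point `z`. -/
theorem IsSubMarkov.rpow_le {α : Type*} [MeasurableSpace α] {m : Measure α}
    {P : (α → ℝ≥0∞) → α → ℝ≥0∞} (hP : IsSubMarkov m P) {r : ℝ} (hr : 1 < r) {g : α → ℝ≥0∞}
    (hg : Measurable g) (z : α) : P g z ^ r ≤ P (fun y => g y ^ r) z := by
  refine ennreal_rpow_le_of_tangent_le hr fun b hb => ?_
  have hne : ENNReal.ofReal r * b ^ (r - 1) ≠ ∞ :=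
    ENNReal.mul_ne_top ENNReal.ofReal_ne_top (ENNReal.rpow_ne_top_of_nonneg (by linarith) hb)
  rw [← hP.const_mul _ hne]
  refine le_trans (hP.mono _ (fun y => g y ^ r + ENNReal.ofReal (r - 1) * b ^ r)
    (fun y => ennreal_tangent_le hr _ _) z) ?_
  exact hP.add_const _ (hg.pow_const r) _ _

/-- Sub-Markovian operators are contractions in all `L^p` spaces. -/
theorem IsSubMarkov.eLpNorm_le {α : Type*} [MeasurableSpace α] {m : Measure α}
    {P : (α → ℝ≥0∞) → α → ℝ≥0∞} (hP : IsSubMarkov m P) {p : ℝ≥0∞} (hp : 1 ≤ p) {g : α → ℝ≥0∞}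
    (hg : Measurable g) : eLpNorm (P g) p m ≤ eLpNorm g p m := by
  rcases eq_or_ne p ∞ with rfl | hp'
  · set M := eLpNorm g ∞ m with hM
    have hgM : ∀ᵐ z ∂m, g z ≤ M := by
      rw [hM, eLpNorm_exponent_top]
      filter_upwards [ae_le_eLpNormEssSup (f := g) (μ := m)] with z hz
      simpa using hz
    -- `P` acts on functions rather than on classes, so a null set where `g` exceeds `M` cannot be
    -- ignored outright; the integral bound shows that `P` of the excess vanishes almost everywhere.
    have hsub : ∫⁻ z, P (fun y => g y - M) z ∂m = 0 := by
      refine le_antisymm ((hP.lintegral_le _ (hg.sub_const M)).trans ?_) zero_le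
      rw [nonpos_iff_eq_zero, lintegral_eq_zero_iff (hg.sub_const M)]
      filter_upwards [hgM] with z hz
      exact tsub_eq_zero_of_le hz
    rw [lintegral_eq_zero_iff (hP.measurable _ (hg.sub_const M))] at hsub
    rw [eLpNorm_exponent_top]
    refine essSup_le_of_ae_le _ ?_
    filter_upwards [hsub] with z hz
    have h1 := hP.mono g (fun y => (g y - M) + M) (fun y => le_tsub_add) z
    have h2 := hP.add_const _ (hg.sub_const M) M z
    rw [hz] at h2
    simpa using h1.trans h2
  · rcases hp.eq_or_lt with rfl | hp1
    · simpa [eLpNorm_one_eq_lintegral_enorm] using hP.lintegral_le g hg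
    · have hr : 1 < p.toReal := by
        rw [← ENNReal.toReal_one]
        exact (ENNReal.toReal_lt_toReal ENNReal.one_ne_top hp').2 hp1
      have hp0 : p ≠ 0 := (one_pos.trans hp1).ne'
      rw [eLpNorm_eq_lintegral_rpow_enorm_toReal hp0 hp',
        eLpNorm_eq_lintegral_rpow_enorm_toReal hp0 hp']
      refine ENNReal.rpow_le_rpow ?_ (by positivity)
      simp only [enorm_eq_self]
      exact (lintegral_mono fun z => hP.rpow_le hr hg z).trans
        (hP.lintegral_le _ (hg.pow_const _))

theorem isSubMarkov_lineInt {C : ℝ} (hC : 0 < C) {Ω : Set (Space d)} (hΩ : MeasurableSet Ω) :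
    IsSubMarkov (phaseMeasure Ω) fun g z => ENNReal.ofReal C * lineInt C Ω g z where
  measurable g hg := (measurable_lineInt hΩ hg).const_mul _
  mono g h hgh z := by
    dsimp only
    gcongr
    exact lineInt_mono hgh z
  const_mul c hc g z := by
    rw [lineInt_const_mul _ hc]; ring
  add_const g hg c z := by
    refine (mul_le_mul_right (lineInt_add_const_le hC g c z) _).trans ?_
    rw [mul_add, ← mul_assoc, ENNReal.mul_inv_cancel (by simpa using hC) ENNReal.ofReal_ne_top,
      one_mul]
  lintegral_le g hg := by
    rw [lintegral_const_mul' _ _ ENNReal.ofReal_ne_top]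
    exact lintegral_lineInt_le hC hΩ hg.aemeasurable

/-! ### The collision operator -/

section Collision

/-- The operator `α + β K` on nonnegative functions. -/
def coll (f : Dir d → Dir d → ℝ) (α β : Space d → ℝ≥0∞) (g : Space d × Dir d → ℝ≥0∞)
    (z : Space d × Dir d) : ℝ≥0∞ :=
  α z.1 * g z + β z.1 * ∫⁻ θ', ENNReal.ofReal (f z.2 θ') * g (z.1, θ') ∂(angularMeasure d)

variable {f : Dir d → Dir d → ℝ} {α β : Space d → ℝ≥0∞}

theorem IsScatteringKernel.integrable (hf : IsScatteringKernel f) (θ : Dir d) :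
    Integrable (f θ) (angularMeasure d) := by
  by_contra h
  have := hf.integral_eq_one θ
  rw [integral_undef h] at this
  exact zero_ne_one this

theorem IsScatteringKernel.lintegral_eq_one (hf : IsScatteringKernel f) (θ : Dir d) :
    ∫⁻ θ', ENNReal.ofReal (f θ θ') ∂(angularMeasure d) = 1 := by
  rw [← ofReal_integral_eq_lintegral_ofReal (hf.integrable θ) (ae_of_all _ (hf.nonneg θ)),
    hf.integral_eq_one, ENNReal.ofReal_one]

theorem measurable_scatter_integrand (hf : IsScatteringKernel f) {g : Space d × Dir d → ℝ≥0∞}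
    (hg : Measurable g) : Measurable fun q : (Space d × Dir d) × Dir d =>
      ENNReal.ofReal (f q.1.2 q.2) * g (q.1.1, q.2) := by
  have h1 : Measurable fun q : (Space d × Dir d) × Dir d => f q.1.2 q.2 :=
    hf.measurable.comp ((measurable_snd.comp measurable_fst).prodMk measurable_snd)
  exact h1.ennreal_ofReal.mul (by fun_prop)

theorem measurable_coll (hf : IsScatteringKernel f) (hα : Measurable α) (hβ : Measurable β)
    {g : Space d × Dir d → ℝ≥0∞} (hg : Measurable g) : Measurable (coll f α β g) := by
  unfold coll
  exact ((hα.comp measurable_fst).mul hg).add ((hβ.comp measurable_fst).mul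
    (measurable_scatter_integrand hf hg).lintegral_prod_right')

theorem coll_mono {g h : Space d × Dir d → ℝ≥0∞} (hgh : g ≤ h) :
    coll f α β g ≤ coll f α β h := fun z => by
  unfold coll
  gcongr
  · exact hgh z
  · exact hgh _

theorem coll_const_mul (g : Space d × Dir d → ℝ≥0∞) {c : ℝ≥0∞} (hc : c ≠ ∞)
    (z : Space d × Dir d) : coll f α β (fun y => c * g y) z = c * coll f α β g z := by
  unfold coll
  have : ∀ θ', ENNReal.ofReal (f z.2 θ') * (c * g (z.1, θ'))
      = c * (ENNReal.ofReal (f z.2 θ') * g (z.1, θ')) := fun θ' => by ring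
  simp_rw [this]
  rw [lintegral_const_mul' _ _ hc]
  ring

theorem coll_add (hf : IsScatteringKernel f) {g : Space d × Dir d → ℝ≥0∞} (hg : Measurable g)
    (h : Space d × Dir d → ℝ≥0∞) (z : Space d × Dir d) :
    coll f α β (fun y => g y + h y) z = coll f α β g z + coll f α β h z := by
  unfold coll
  simp_rw [mul_add]
  have hm : Measurable fun θ' => ENNReal.ofReal (f z.2 θ') * g (z.1, θ') :=
    (measurable_scatter_integrand hf hg).comp measurable_prodMk_left
  rw [lintegral_add_left hm]
  ring

theorem coll_const (hf : IsScatteringKernel f) (c : ℝ≥0∞) (z : Space d × Dir d) :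
    coll f α β (fun _ => c) z = (α z.1 + β z.1) * c := by
  have hm : Measurable fun θ' => ENNReal.ofReal (f z.2 θ') :=
    (hf.measurable.comp measurable_prodMk_left).ennreal_ofReal
  unfold coll
  rw [lintegral_mul_const _ hm, hf.lintegral_eq_one]
  ring

theorem coll_iSup (hf : IsScatteringKernel f) {g : ℕ → Space d × Dir d → ℝ≥0∞}
    (hg : ∀ n, Measurable (g n)) (hmono : Monotone g) (z : Space d × Dir d) :
    coll f α β (fun y => ⨆ n, g n y) z = ⨆ n, coll f α β (g n) z := by
  unfold coll
  simp_rw [ENNReal.mul_iSup]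
  rw [lintegral_iSup, ENNReal.mul_iSup, ENNReal.iSup_add_iSup_of_monotone]
  · intro m n hmn
    dsimp only
    gcongr
    exact hmono hmn z
  · intro m n hmn
    dsimp only
    gcongr
    exact hmono hmn _
  · exact fun n => (measurable_scatter_integrand hf (hg n)).comp measurable_prodMk_left
  · intro m n hmn θ
    dsimp only
    gcongr
    exact hmono hmn _

/-- Integrating out the outgoing direction first, the symmetry of `f` turns its normalisation in the
second variable into normalisation in the first, so scattering conserves the angular integral. -/
theorem lintegral_coll (hf : IsScatteringKernel f) (Ω : Set (Space d)) (hα : Measurable α)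
    (hβ : Measurable β) {g : Space d × Dir d → ℝ≥0∞} (hg : Measurable g) :
    ∫⁻ z, coll f α β g z ∂(phaseMeasure Ω) = ∫⁻ z, (α z.1 + β z.1) * g z ∂(phaseMeasure Ω) := by
  have hm := measurable_scatter_integrand hf hg
  have hβg : Measurable fun z : Space d × Dir d => β z.1 * g z :=
    (hβ.comp measurable_fst).mul hg
  have hαg : Measurable fun z : Space d × Dir d => α z.1 * g z :=
    (hα.comp measurable_fst).mul hg
  unfold coll
  simp_rw [add_mul]
  rw [lintegral_add_left hαg, lintegral_add_left hαg]
  congr 1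
  unfold phaseMeasure
  have hK : Measurable fun z : Space d × Dir d => β z.1 *
      ∫⁻ θ', ENNReal.ofReal (f z.2 θ') * g (z.1, θ') ∂(angularMeasure d) :=
    (hβ.comp measurable_fst).mul hm.lintegral_prod_right'
  rw [lintegral_prod _ hK.aemeasurable, lintegral_prod _ hβg.aemeasurable]
  refine lintegral_congr fun x => ?_
  dsimp only
  have hgx : Measurable fun θ => g (x, θ) := hg.comp measurable_prodMk_left
  have hff : Measurable fun q : Dir d × Dir d => ENNReal.ofReal (f q.1 q.2) :=
    hf.measurable.ennreal_ofReal
  have hmx : Measurable fun q : Dir d × Dir d => ENNReal.ofReal (f q.1 q.2) * g (x, q.2) :=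
    hff.mul (hgx.comp measurable_snd)
  rw [lintegral_const_mul _ hmx.lintegral_prod_right', lintegral_const_mul _ hgx]
  congr 1
  rw [lintegral_lintegral_swap hmx.aemeasurable]
  refine lintegral_congr fun θ' => ?_
  have hfθ : Measurable fun θ => ENNReal.ofReal (f θ θ') := hff.comp measurable_prodMk_right
  dsimp only
  rw [lintegral_mul_const _ hfθ]
  simp_rw [fun θ => hf.symm θ θ']
  rw [hf.lintegral_eq_one, one_mul]

theorem isSubMarkov_coll (hf : IsScatteringKernel f) (Ω : Set (Space d)) (hα : Measurable α)
    (hβ : Measurable β) {D : ℝ} (hD : 0 < D) (h : ∀ x, α x + β x ≤ ENNReal.ofReal D) :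
    IsSubMarkov (phaseMeasure Ω) fun g z => (ENNReal.ofReal D)⁻¹ * coll f α β g z := by
  have hne : (ENNReal.ofReal D)⁻¹ ≠ ∞ := by simpa using hD
  have hcancel : ∀ a : ℝ≥0∞, (ENNReal.ofReal D)⁻¹ * (ENNReal.ofReal D * a) = a := fun a => by
    rw [← mul_assoc, ENNReal.inv_mul_cancel (by simpa using hD) ENNReal.ofReal_ne_top, one_mul]
  refine ⟨fun g hg => (measurable_coll hf hα hβ hg).const_mul _, fun g k hgk z => ?_,
    fun c hc g z => ?_, fun g hg c z => ?_, fun g hg => ?_⟩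
  · dsimp only
    gcongr
    exact coll_mono hgk z
  · rw [coll_const_mul _ hc]; ring
  · rw [coll_add hf hg, coll_const hf, mul_add]
    gcongr
    calc _ ≤ (ENNReal.ofReal D)⁻¹ * (ENNReal.ofReal D * c) := by gcongr; exact h _
      _ = c := hcancel c
  · rw [lintegral_const_mul' _ _ hne, lintegral_coll hf Ω hα hβ hg]
    calc _ ≤ (ENNReal.ofReal D)⁻¹ * ∫⁻ z, ENNReal.ofReal D * g z ∂(phaseMeasure Ω) := by
          gcongr; exact h _
      _ = _ := by rw [lintegral_const_mul' _ _ ENNReal.ofReal_ne_top, hcancel]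

/-! ### Fixed points of the Picard iteration -/

theorem eLpNorm_iSup_le {α : Type*} [MeasurableSpace α] {m : Measure α} {p : ℝ≥0∞} (hp : 1 ≤ p)
    {g : ℕ → α → ℝ≥0∞} (hg : ∀ n, Measurable (g n)) (hmono : Monotone g) {B : ℝ≥0∞}
    (hB : ∀ n, eLpNorm (g n) p m ≤ B) : eLpNorm (fun z => ⨆ n, g n z) p m ≤ B := by
  rcases eq_or_ne p ∞ with rfl | hp'
  · rw [eLpNorm_exponent_top]
    refine essSup_le_of_ae_le _ ?_
    have h : ∀ᵐ z ∂m, ∀ n, g n z ≤ B := ae_all_iff.2 fun n => by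
      have hn := hB n
      rw [eLpNorm_exponent_top] at hn
      filter_upwards [ae_le_eLpNormEssSup (f := g n) (μ := m)] with z hz
      exact le_trans (by simpa using hz) hn
    filter_upwards [h] with z hz
    simpa using hz
  · have hp0 : p ≠ 0 := (one_pos.trans_le hp).ne'
    have hr : 0 < p.toReal := ENNReal.toReal_pos hp0 hp'
    simp only [eLpNorm_eq_lintegral_rpow_enorm_toReal hp0 hp', enorm_eq_self] at hB ⊢
    have hcont : ∀ z, (⨆ n, g n z) ^ p.toReal = ⨆ n, g n z ^ p.toReal := fun z =>
      (ENNReal.orderIsoRpow p.toReal hr).map_iSup _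
    simp_rw [hcont]
    rw [lintegral_iSup (fun n => (hg n).pow_const _)
      (fun m n hmn z => ENNReal.rpow_le_rpow (hmono hmn z) hr.le)]
    rw [one_div, ENNReal.rpow_inv_le_iff hr]
    refine iSup_le fun n => ?_
    rw [← ENNReal.rpow_inv_le_iff hr, ← one_div]
    exact hB n

theorem eLpNorm_const_mul_le {α : Type*} [MeasurableSpace α] {m : Measure α} (p : ℝ≥0∞)
    {k : ℝ≥0∞} (hk : k ≠ ∞) (g : α → ℝ≥0∞) :
    eLpNorm (fun z => k * g z) p m ≤ k * eLpNorm g p m := by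
  lift k to NNReal using hk
  exact eLpNorm_le_nnreal_smul_eLpNorm_of_ae_le_mul' (ae_of_all _ fun z => le_rfl) p

theorem eLpNorm_lineInt_le {C : ℝ} (hC : 0 < C) {Ω : Set (Space d)} (hΩ : MeasurableSet Ω)
    {p : ℝ≥0∞} (hp : 1 ≤ p) {g : Space d × Dir d → ℝ≥0∞} (hg : Measurable g) :
    eLpNorm (lineInt C Ω g) p (phaseMeasure Ω)
      ≤ (ENNReal.ofReal C)⁻¹ * eLpNorm g p (phaseMeasure Ω) := by
  have h0 : ENNReal.ofReal C ≠ 0 := by simpa using hC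
  have e : lineInt C Ω g
      = fun z => (ENNReal.ofReal C)⁻¹ * (ENNReal.ofReal C * lineInt C Ω g z) := by
    funext z
    rw [← mul_assoc, ENNReal.inv_mul_cancel h0 ENNReal.ofReal_ne_top, one_mul]
  rw [e]
  refine (eLpNorm_const_mul_le p (by simpa using hC) _).trans ?_
  gcongr
  exact (isSubMarkov_lineInt hC hΩ).eLpNorm_le hp hg

theorem eLpNorm_coll_le (hf : IsScatteringKernel f) (Ω : Set (Space d)) (hα : Measurable α)
    (hβ : Measurable β) {D : ℝ} (hD : 0 < D) (h : ∀ x, α x + β x ≤ ENNReal.ofReal D)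
    {p : ℝ≥0∞} (hp : 1 ≤ p) {g : Space d × Dir d → ℝ≥0∞} (hg : Measurable g) :
    eLpNorm (coll f α β g) p (phaseMeasure Ω)
      ≤ ENNReal.ofReal D * eLpNorm g p (phaseMeasure Ω) := by
  have h0 : ENNReal.ofReal D ≠ 0 := by simpa using hD
  have e : coll f α β g
      = fun z => ENNReal.ofReal D * ((ENNReal.ofReal D)⁻¹ * coll f α β g z) := by
    funext z
    rw [← mul_assoc, ENNReal.mul_inv_cancel h0 ENNReal.ofReal_ne_top, one_mul]
  rw [e]
  refine (eLpNorm_const_mul_le p ENNReal.ofReal_ne_top _).trans ?_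
  gcongr
  exact (isSubMarkov_coll hf Ω hα hβ hD h).eLpNorm_le hp hg

/-- The Picard iterates of `ψ = L (r + H ψ)`, with `L` the damped line integral and `H` the
collision operator. -/
def picard (C : ℝ) (Ω : Set (Space d)) (f : Dir d → Dir d → ℝ) (α β : Space d → ℝ≥0∞)
    (r : Space d × Dir d → ℝ≥0∞) : ℕ → Space d × Dir d → ℝ≥0∞
  | 0 => fun _ => 0
  | n + 1 => lineInt C Ω fun y => r y + coll f α β (picard C Ω f α β r n) y

theorem measurable_picard (C : ℝ) {Ω : Set (Space d)} (hΩ : MeasurableSet Ω)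
    (hf : IsScatteringKernel f) (hα : Measurable α) (hβ : Measurable β)
    {r : Space d × Dir d → ℝ≥0∞} (hr : Measurable r) (n : ℕ) :
    Measurable (picard C Ω f α β r n) := by
  induction n with
  | zero => exact measurable_const
  | succ n ih => exact measurable_lineInt hΩ (hr.add (measurable_coll hf hα hβ ih))

theorem picard_mono (C : ℝ) (Ω : Set (Space d)) (f : Dir d → Dir d → ℝ) (α β : Space d → ℝ≥0∞)
    (r : Space d × Dir d → ℝ≥0∞) : Monotone (picard C Ω f α β r) := by
  refine monotone_nat_of_le_succ fun n => ?_
  induction n with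
  | zero => exact fun z => zero_le
  | succ n ih =>
    refine lineInt_mono fun y => ?_
    gcongr
    exact coll_mono ih y

/-- The iterates increase from zero, and the bound `1 / c` reproduces itself because `(1 + D / c) /
(c + D) = 1 / c`. With values in `ℝ≥0∞` the limit exists at every point, so the fixed point equation
holds everywhere; it can then be evaluated along individual lines. -/
theorem exists_fixedPoint_lineInt_coll {Ω : Set (Space d)} (hΩ : MeasurableSet Ω)
    (hf : IsScatteringKernel f) (hα : Measurable α) (hβ : Measurable β) {c D : ℝ} (hc : 0 < c)
    (hD : 0 < D) (h : ∀ x, α x + β x ≤ ENNReal.ofReal D) {r : Space d × Dir d → ℝ≥0∞}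
    (hr : Measurable r) :
    ∃ ψ : Space d × Dir d → ℝ≥0∞, Measurable ψ ∧
      (∀ z, ψ z = lineInt (c + D) Ω (fun y => r y + coll f α β ψ y) z) ∧
      ∀ p : ℝ≥0∞, 1 ≤ p → eLpNorm ψ p (phaseMeasure Ω)
        ≤ (ENNReal.ofReal c)⁻¹ * eLpNorm r p (phaseMeasure Ω) := by
  have hC : 0 < c + D := by linarith
  have hm := measurable_picard (c + D) hΩ hf hα hβ hr
  have hmono := picard_mono (c + D) Ω f α β r
  refine ⟨fun z => ⨆ n, picard (c + D) Ω f α β r n z, Measurable.iSup hm, fun z => ?_,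
    fun p hp => eLpNorm_iSup_le hp hm hmono fun n => ?_⟩
  · have e : (fun y => r y + coll f α β (fun z => ⨆ n, picard (c + D) Ω f α β r n z) y)
        = fun y => ⨆ n, (r y + coll f α β (picard (c + D) Ω f α β r n) y) := by
      funext y
      rw [coll_iSup hf hm hmono, ENNReal.add_iSup]
    rw [e, lineInt_iSup hΩ (g := fun n y => r y + coll f α β (picard (c + D) Ω f α β r n) y)
      (fun n => hr.add (measurable_coll hf hα hβ (hm n)))]
    · exact (Monotone.iSup_nat_add (f := fun n => picard (c + D) Ω f α β r n z)
        (fun m n hmn => hmono hmn z) 1).symm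
    · intro m n hmn y
      dsimp only
      gcongr
      exact coll_mono (hmono hmn) y
  · induction n with
    | zero => simp [picard]
    | succ n ih =>
      set N := eLpNorm r p (phaseMeasure Ω)
      have hcoll := measurable_coll hf hα hβ (hm n)
      have hc0 : ENNReal.ofReal c ≠ 0 := by simpa using hc
      calc eLpNorm (picard (c + D) Ω f α β r (n + 1)) p (phaseMeasure Ω)
          ≤ (ENNReal.ofReal (c + D))⁻¹
            * eLpNorm (r + coll f α β (picard (c + D) Ω f α β r n)) p (phaseMeasure Ω) :=
            eLpNorm_lineInt_le hC hΩ hp (hr.add hcoll)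
        _ ≤ (ENNReal.ofReal (c + D))⁻¹ * (N
            + ENNReal.ofReal D * ((ENNReal.ofReal c)⁻¹ * N)) := by
            gcongr
            refine (eLpNorm_add_le hr.aestronglyMeasurable hcoll.aestronglyMeasurable hp).trans ?_
            gcongr
            refine (eLpNorm_coll_le hf Ω hα hβ hD h hp (hm n)).trans ?_
            gcongr
        _ = (ENNReal.ofReal (c + D))⁻¹ * ((ENNReal.ofReal c * (ENNReal.ofReal c)⁻¹) * N
            + ENNReal.ofReal D * ((ENNReal.ofReal c)⁻¹ * N)) := by
            rw [ENNReal.mul_inv_cancel hc0 ENNReal.ofReal_ne_top, one_mul]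
        _ = ((ENNReal.ofReal (c + D))⁻¹ * ENNReal.ofReal (c + D))
            * ((ENNReal.ofReal c)⁻¹ * N) := by
            rw [ENNReal.ofReal_add hc.le hD.le]; ring
        _ = _ := by
            rw [ENNReal.inv_mul_cancel (by simpa using hC) ENNReal.ofReal_ne_top, one_mul]

end Collision

/-! ### Geometry of characteristic lines in a convex domain -/

section Lines

variable {Ω : Set (Space d)}

theorem flow_mem_of_mem_Icc (hc : Convex ℝ Ω) {z : Space d × Dir d} {a b t : ℝ}
    (ha : (flow z a).1 ∈ Ω) (hb : (flow z b).1 ∈ Ω) (ht : t ∈ Icc a b) : (flow z t).1 ∈ Ω := by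
  have hconv : Convex ℝ {s : ℝ | (flow z s).1 ∈ Ω} := by
    have h := hc.affine_preimage (AffineMap.lineMap z.1 (z.1 + (z.2 : Space d)) : ℝ →ᵃ[ℝ] Space d)
    have e : {s : ℝ | (flow z s).1 ∈ Ω}
        = (AffineMap.lineMap z.1 (z.1 + (z.2 : Space d)) : ℝ →ᵃ[ℝ] Space d) ⁻¹' Ω := by
      ext s
      simp [flow, AffineMap.lineMap_apply, add_comm]
    rw [e]
    exact h
  exact hconv.ordConnected.out ha hb ht

theorem isOpen_setOf_flow_mem (ho : IsOpen Ω) (z : Space d × Dir d) :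
    IsOpen {t : ℝ | (flow z t).1 ∈ Ω} := by
  refine ho.preimage ?_
  unfold flow
  fun_prop

theorem bddAbove_backTime (hb : Bornology.IsBounded Ω) (z : Space d × Dir d) :
    BddAbove {t : ℝ | 0 ≤ t ∧ z.1 - t • (z.2 : Space d) ∈ Ω} := by
  obtain ⟨R, hR⟩ := hb.exists_norm_le
  refine ⟨‖z.1‖ + R, fun t ht => ?_⟩
  have h1 := hR _ ht.2
  have h2 : ‖t • (z.2 : Space d)‖ = t := by
    rw [norm_smul, norm_eq_of_mem_sphere, mul_one, Real.norm_of_nonneg ht.1]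
  have h3 : ‖t • (z.2 : Space d)‖ ≤ ‖z.1‖ + ‖z.1 - t • (z.2 : Space d)‖ := by
    have := norm_sub_le z.1 (z.1 - t • (z.2 : Space d))
    rwa [sub_sub_cancel] at this
  linarith

/-- Convexity makes the times spent in `Ω` an interval, boundedness makes the supremum in `backTime`
meaningful, and openness excludes the entry time. -/
theorem flow_mem_iff_of_nonpos (ho : IsOpen Ω) (hb : Bornology.IsBounded Ω) (hc : Convex ℝ Ω)
    {z : Space d × Dir d} (hz : z.1 ∈ Ω) {t : ℝ} (ht : t ≤ 0) :
    (flow z t).1 ∈ Ω ↔ -backTime Ω z < t := by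
  have hset : ∀ s : ℝ, z.1 - s • (z.2 : Space d) = (flow z (-s)).1 := fun s => by
    simp [flow, sub_eq_add_neg]
  have hbd := bddAbove_backTime hb z
  constructor
  · intro h
    obtain ⟨ε, hε, hball⟩ := Metric.isOpen_iff.1 (isOpen_setOf_flow_mem ho z) t h
    -- Room for a further backward step makes the inequality strict.
    have hmem : (flow z (t - ε / 2)).1 ∈ Ω := hball (by
      rw [Metric.mem_ball, Real.dist_eq]
      rw [show t - ε / 2 - t = -(ε / 2) by ring, abs_neg, abs_of_pos (by linarith)]
      linarith)
    have : -t + ε / 2 ≤ backTime Ω z := le_csSup hbd ⟨by linarith, by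
      rw [hset, show -(-t + ε / 2) = t - ε / 2 by ring]; exact hmem⟩
    linarith
  · intro h
    have hne : {t : ℝ | 0 ≤ t ∧ z.1 - t • (z.2 : Space d) ∈ Ω}.Nonempty := ⟨0, le_rfl, by simpa⟩
    obtain ⟨s, hs, hts⟩ := exists_lt_of_lt_csSup hne (show -t < backTime Ω z by linarith)
    refine flow_mem_of_mem_Icc hc (a := -s) (b := 0) ?_ (by simpa using hz) ⟨by linarith, ht⟩
    rw [← hset]; exact hs.2

theorem backTime_pos (ho : IsOpen Ω) (hb : Bornology.IsBounded Ω) (hc : Convex ℝ Ω)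
    {z : Space d × Dir d} (hz : z.1 ∈ Ω) : 0 < backTime Ω z := by
  have := (flow_mem_iff_of_nonpos ho hb hc hz le_rfl).1 (by simpa using hz)
  linarith

theorem flow_mem_iff_of_le (ho : IsOpen Ω) (hb : Bornology.IsBounded Ω) (hc : Convex ℝ Ω)
    {z : Space d × Dir d} (hz : z.1 ∈ Ω) {t b : ℝ} (hbΩ : (flow z b).1 ∈ Ω) (ht : t ≤ b) :
    (flow z t).1 ∈ Ω ↔ -backTime Ω z < t := by
  rcases le_total t 0 with h | h
  · exact flow_mem_iff_of_nonpos ho hb hc hz h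
  · have := backTime_pos ho hb hc hz
    exact iff_of_true (flow_mem_of_mem_Icc hc (by simpa using hz) hbΩ ⟨h, ht⟩) (by linarith)

theorem backTime_flow (ho : IsOpen Ω) (hb : Bornology.IsBounded Ω) (hc : Convex ℝ Ω)
    {z : Space d × Dir d} (hz : z.1 ∈ Ω) {t : ℝ} (ht : (flow z t).1 ∈ Ω) :
    backTime Ω (flow z t) = backTime Ω z + t := by
  have h0 := (flow_mem_iff_of_le ho hb hc hz ht le_rfl).1 ht
  have hset : {s : ℝ | 0 ≤ s ∧ (flow z t).1 - s • ((flow z t).2 : Space d) ∈ Ω}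
      = Ico 0 (backTime Ω z + t) := by
    ext s
    have e : (flow z t).1 - s • ((flow z t).2 : Space d) = (flow z (t - s)).1 := by
      simp [flow, sub_eq_add_neg, add_smul, add_assoc]
    rw [mem_ofPred_eq, e, mem_Ico]
    refine and_congr_right fun hs => ?_
    rw [flow_mem_iff_of_le ho hb hc hz ht (by linarith)]
    constructor <;> intro h <;> linarith
  rw [backTime, hset, csSup_Ico (by linarith)]

theorem inflowExt_flow (ho : IsOpen Ω) (hb : Bornology.IsBounded Ω) (hc : Convex ℝ Ω)
    (qb : Space d × Dir d → ℝ) {z : Space d × Dir d} (hz : z.1 ∈ Ω) {t : ℝ}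
    (ht : (flow z t).1 ∈ Ω) : inflowExt Ω qb (flow z t) = inflowExt Ω qb z := by
  unfold inflowExt inflowPoint
  rw [backTime_flow ho hb hc hz ht]
  congr 2
  simp only [flow, add_smul]
  abel

theorem lineInt_eq_setLIntegral_Ioo (ho : IsOpen Ω) (hb : Bornology.IsBounded Ω)
    (hc : Convex ℝ Ω) (C : ℝ) (g : Space d × Dir d → ℝ≥0∞) {z : Space d × Dir d}
    (hz : z.1 ∈ Ω) :
    lineInt C Ω g z
      = ∫⁻ t in Ioo (-backTime Ω z) 0, ENNReal.ofReal (Real.exp (C * t)) * g (flow z t) := by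
  unfold lineInt
  rw [← lintegral_indicator measurableSet_Iio, ← lintegral_indicator measurableSet_Ioo]
  congr with t
  by_cases h0 : t < 0
  · have hiff := flow_mem_iff_of_nonpos ho hb hc hz h0.le
    by_cases h1 : -backTime Ω z < t
    · have h2 : flow z t ∈ (Prod.fst ⁻¹' Ω : Set (Space d × Dir d)) := hiff.2 h1
      rw [indicator_of_mem (show t ∈ Iio 0 from h0),
        indicator_of_mem (show t ∈ Ioo _ _ from ⟨h1, h0⟩), indicator_of_mem h2]
    · have h2 : flow z t ∉ (Prod.fst ⁻¹' Ω : Set (Space d × Dir d)) := fun h => h1 (hiff.1 h)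
      rw [indicator_of_mem (show t ∈ Iio 0 from h0),
        indicator_of_notMem (show t ∉ Ioo _ _ from fun h => h1 h.1),
        indicator_of_notMem h2, mul_zero]
  · rw [indicator_of_notMem (show t ∉ Iio 0 from h0),
      indicator_of_notMem (show t ∉ Ioo _ _ from fun h => h0 h.2)]

end Lines

/-! ### Linear equations on a line -/

theorem absolutelyContinuousOnInterval_exp_mul (C a b : ℝ) :
    AbsolutelyContinuousOnInterval (fun t : ℝ => Real.exp (C * t)) a b := by
  refine ContDiffOn.absolutelyContinuousOnInterval (ContDiff.contDiffOn ?_)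
  fun_prop

theorem hasDerivAt_exp_const_mul (C t : ℝ) :
    HasDerivAt (fun s : ℝ => Real.exp (C * s)) (C * Real.exp (C * t)) t := by
  have := ((hasDerivAt_id t).const_mul C).exp
  simpa [mul_comm] using this

theorem integrableOn_exp_mul {C T : ℝ} {g : ℝ → ℝ} (hint : IntegrableOn g (Ioo (-T) 0)) :
    IntegrableOn (fun t => Real.exp (C * t) * g t) (Ioo (-T) 0) := by
  have h1 : IntegrableOn g (Icc (-T) 0) := (integrableOn_Icc_iff_integrableOn_Ioo).2 hint
  exact (h1.continuousOn_mul (by fun_prop) isCompact_Icc).mono_set Ioo_subset_Icc_self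

/-- Duhamel's formula for `v' + C v = g` on `(-T, 0)`. -/
theorem duhamel_of_hasDerivAt {v g : ℝ → ℝ} {T C v₀ : ℝ} (hT : 0 < T)
    (hac : ∀ a ∈ Ioo (-T) 0, AbsolutelyContinuousOnInterval v a 0)
    (hder : ∀ᵐ t : ℝ, t ∈ Ioo (-T) 0 → HasDerivAt v (g t - C * v t) t)
    (hint : IntegrableOn g (Ioo (-T) 0)) (hlim : Tendsto v (𝓝[>] (-T)) (𝓝 v₀)) :
    v 0 = Real.exp (-(C * T)) * v₀ + ∫ t in Ioo (-T) 0, Real.exp (C * t) * g t := by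
  have hint' := integrableOn_exp_mul (C := C) hint
  -- With the integrating factor `exp (C t)`, the fundamental theorem for absolutely continuous
  -- functions applies on `[a, 0]`. At `-T` only a limit of `v` is known, so `a` tends to `-T`
  -- afterwards.
  have key : ∀ a ∈ Ioo (-T) 0,
      v 0 = Real.exp (C * a) * v a + ∫ t in a..0, Real.exp (C * t) * g t := by
    intro a ha
    have hw := (absolutelyContinuousOnInterval_exp_mul C a 0).mul (hac a ha)
    have h1 := hw.integral_deriv_eq_sub
    have h2 : ∫ t in a..0, deriv ((fun t : ℝ => Real.exp (C * t)) * v) t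
        = ∫ t in a..0, Real.exp (C * t) * g t := by
      refine intervalIntegral.integral_congr_ae ?_
      have hne : ∀ᵐ t : ℝ, t ≠ 0 := by simp [ae_iff, measure_singleton]
      filter_upwards [hder, hne] with t ht ht0 hta
      rw [uIoc_of_le ha.2.le] at hta
      have h3 := (hasDerivAt_exp_const_mul C t).mul
        (ht ⟨by linarith [ha.1, hta.1], lt_of_le_of_ne hta.2 ht0⟩)
      rw [h3.deriv]
      ring
    rw [h2] at h1
    rw [h1]
    simp
  have hIoc : IntegrableOn (fun t => Real.exp (C * t) * g t) (uIcc (-T) 0) := by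
    rw [uIcc_of_le (by linarith)]
    exact (integrableOn_Icc_iff_integrableOn_Ioo).2 hint'
  have hcont := intervalIntegral.continuousOn_primitive_interval_left hIoc
  have h4 : Tendsto (fun a => ∫ t in a..0, Real.exp (C * t) * g t) (𝓝[>] (-T))
      (𝓝 (∫ t in (-T)..0, Real.exp (C * t) * g t)) := by
    have h5 := hcont (-T) left_mem_uIcc
    rw [uIcc_of_le (by linarith)] at h5
    have h6 : 𝓝[>] (-T) ≤ 𝓝[Icc (-T) 0] (-T) := by
      rw [← nhdsWithin_Ioo_eq_nhdsGT (show -T < 0 by linarith)]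
      exact nhdsWithin_mono _ Ioo_subset_Icc_self
    exact h5.mono_left h6
  have h7 : Tendsto (fun a => Real.exp (C * a)) (𝓝[>] (-T)) (𝓝 (Real.exp (C * -T))) :=
    ((by fun_prop : Continuous fun a : ℝ => Real.exp (C * a)).tendsto _).mono_left
      nhdsWithin_le_nhds
  have h8 := (h7.mul hlim).add h4
  have h9 : Tendsto (fun _ : ℝ => v 0) (𝓝[>] (-T)) (𝓝 (v 0)) := tendsto_const_nhds
  have h10 : (fun a => Real.exp (C * a) * v a + ∫ t in a..0, Real.exp (C * t) * g t)
      =ᶠ[𝓝[>] (-T)] fun _ => v 0 := by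
    filter_upwards [Ioo_mem_nhdsGT (show -T < 0 by linarith)] with a ha
    exact (key a ha).symm
  have h11 := tendsto_nhds_unique (h8.congr' h10) h9
  rw [← h11, intervalIntegral.integral_of_le (by linarith), integral_Ioc_eq_integral_Ioo,
    mul_neg]

/-- Conversely, Duhamel's formula defines a solution of `v' + C v = g`. -/
theorem hasDerivAt_of_duhamel {v g : ℝ → ℝ} {T C v₀ : ℝ} {I : Set ℝ} (hI : IsOpen I)
    (hg : LocallyIntegrable g)
    (hv : ∀ t ∈ I, v t = Real.exp (-(C * (T + t))) * v₀
      + Real.exp (-(C * t)) * ∫ s in (-T)..t, Real.exp (C * s) * g s) :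
    (∀ a b, a ≤ b → Icc a b ⊆ I → AbsolutelyContinuousOnInterval v a b) ∧
    (∀ᵐ t : ℝ, t ∈ I → HasDerivAt v (g t - C * v t) t) ∧
    (I ∈ 𝓝[>] (-T) → Tendsto v (𝓝[>] (-T)) (𝓝 v₀)) := by
  have hloc : LocallyIntegrable fun s => Real.exp (C * s) * g s := by
    rw [← locallyIntegrableOn_univ] at hg ⊢
    exact hg.continuousOn_mul (by fun_prop) isOpen_univ.isLocallyClosed
  have hii : ∀ a b, IntervalIntegrable (fun s => Real.exp (C * s) * g s) volume a b :=
    fun a b => intervalIntegrable_iff.2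
      ((hloc.integrableOn_isCompact isCompact_uIcc).mono_set uIoc_subset_uIcc)
  set w : ℝ → ℝ := fun t => Real.exp (-(C * (T + t))) * v₀
      + Real.exp (-(C * t)) * ∫ s in (-T)..t, Real.exp (C * s) * g s with hw
  have e1 : ∀ t, Real.exp (-(C * (T + t))) * v₀
      = (Real.exp (-(C * T)) * v₀) * Real.exp (-C * t) := fun t => by
    rw [show -(C * (T + t)) = -(C * T) + -C * t by ring, Real.exp_add]; ring
  have hw' : w = fun t => Real.exp (-C * t)
      * (Real.exp (-(C * T)) * v₀ + ∫ s in (-T)..t, Real.exp (C * s) * g s) := by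
    funext t
    simp only [hw]
    rw [e1, show -(C * t) = -C * t by ring]; ring
  refine ⟨fun a b hab hsub => ?_, ?_, fun hmem => ?_⟩
  · have hconst : AbsolutelyContinuousOnInterval
        (fun _ : ℝ => Real.exp (-(C * T)) * v₀ + ∫ s in (-T)..a, Real.exp (C * s) * g s) a b :=
      ContDiffOn.absolutelyContinuousOnInterval contDiffOn_const
    have h1 := (hii a b).absolutelyContinuousOnInterval_intervalIntegral (c := a) left_mem_uIcc
    have h2 := (absolutelyContinuousOnInterval_exp_mul (-C) a b).mul (hconst.add h1)
    have h3 : EqOn v ((fun t : ℝ => Real.exp (-C * t)) * ((fun _ : ℝ => Real.exp (-(C * T)) * v₀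
        + ∫ s in (-T)..a, Real.exp (C * s) * g s)
        + fun x => ∫ s in a..x, Real.exp (C * s) * g s)) (uIcc a b) := by
      intro t ht
      rw [uIcc_of_le hab] at ht
      rw [hv t (hsub ht)]
      change w t = _
      rw [hw']
      simp only [Pi.mul_apply, Pi.add_apply]
      rw [add_assoc, intervalIntegral.integral_add_adjacent_intervals (hii _ _) (hii _ _)]
    -- `v` agrees with the explicit formula on `[a, b]` only, so the ε-δ condition is transferred:
    -- it involves no values outside the interval.
    rw [absolutelyContinuousOnInterval_iff] at h2 ⊢
    intro ε hε
    obtain ⟨δ, hδ, hδ'⟩ := h2 ε hε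
    refine ⟨δ, hδ, fun E hE hlt => ?_⟩
    have h4 := hδ' E hE hlt
    refine lt_of_eq_of_lt (Finset.sum_congr rfl fun i hi => ?_) h4
    have hmem := (hE.1 i hi)
    rw [h3 hmem.1, h3 hmem.2]
  · filter_upwards [LocallyIntegrable.ae_hasDerivAt_integral hloc] with t ht htI
    have h1 := (hasDerivAt_exp_const_mul (-C) t).mul
      ((ht (-T)).const_add (Real.exp (-(C * T)) * v₀))
    have h2 : HasDerivAt w (g t - C * w t) t := by
      rw [hw']
      refine h1.congr_deriv ?_
      have : Real.exp (-C * t) * Real.exp (C * t) = 1 := by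
        rw [← Real.exp_add]; simp
      linear_combination (g t) * this
    have h3 : v =ᶠ[𝓝 t] w := by
      filter_upwards [hI.mem_nhds htI] with s hs using hv s hs
    rw [h3.eq_of_nhds]
    exact h2.congr_of_eventuallyEq h3
  · have h1 : ContinuousAt w (-T) := by
      rw [hw']
      have := (intervalIntegral.continuous_primitive (fun a b => hii a b) (-T)).continuousAt
        (x := -T)
      exact ContinuousAt.mul (by fun_prop) (continuousAt_const.add this)
    have h2 : w (-T) = v₀ := by simp [hw]
    have h3 : Tendsto w (𝓝[>] (-T)) (𝓝 v₀) := by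
      have := h1.tendsto.mono_left (nhdsWithin_le_nhds (s := Ioi (-T)))
      rwa [h2] at this
    refine h3.congr' ?_
    filter_upwards [hmem] with s hs using (hv s hs).symm

/-! ### The scattering operator on integrable functions -/

section Scatter

variable {Ω : Set (Space d)} {f : Dir d → Dir d → ℝ}

theorem ae_ae_phaseMeasure {P : Space d × Dir d → Prop} (h : ∀ᵐ z ∂(phaseMeasure Ω), P z) :
    ∀ᵐ z ∂(phaseMeasure Ω), ∀ᵐ θ ∂(angularMeasure d), P (z.1, θ) :=
  ae_phaseMeasure_of_ae (Measure.ae_ae_of_ae_prod h)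

theorem scatter_congr_ae {φ ψ : Space d × Dir d → ℝ} (h : φ =ᵐ[phaseMeasure Ω] ψ) :
    scatter f φ =ᵐ[phaseMeasure Ω] scatter f ψ := by
  filter_upwards [ae_ae_phaseMeasure h] with z hz
  refine integral_congr_ae ?_
  filter_upwards [hz] with θ hθ
  rw [hθ]

theorem stronglyMeasurable_scatter (hf : IsScatteringKernel f) {φ : Space d × Dir d → ℝ}
    (hφ : Measurable φ) : StronglyMeasurable (scatter f φ) := by
  have h1 : Measurable fun q : (Space d × Dir d) × Dir d => f q.1.2 q.2 * φ (q.1.1, q.2) :=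
    (hf.measurable.comp ((measurable_snd.comp measurable_fst).prodMk measurable_snd)).mul
      (by fun_prop)
  exact h1.stronglyMeasurable.integral_prod_right'

theorem enorm_scatter_integrand (hf : IsScatteringKernel f) (φ : Space d × Dir d → ℝ)
    (z : Space d × Dir d) (θ : Dir d) :
    ‖f z.2 θ * φ (z.1, θ)‖ₑ = ENNReal.ofReal (f z.2 θ) * ‖φ (z.1, θ)‖ₑ := by
  rw [enorm_mul, Real.enorm_of_nonneg (hf.nonneg _ _)]

theorem lintegral_lintegral_scatter (hf : IsScatteringKernel f) {g : Space d × Dir d → ℝ≥0∞}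
    (hg : Measurable g) :
    ∫⁻ z, ∫⁻ θ, ENNReal.ofReal (f z.2 θ) * g (z.1, θ) ∂(angularMeasure d) ∂(phaseMeasure Ω)
      = ∫⁻ z, g z ∂(phaseMeasure Ω) := by
  simpa [coll] using lintegral_coll hf Ω (α := fun _ => 0) (β := fun _ => 1) measurable_const
    measurable_const hg

/-- Scattering preserves the total integral of `|φ|`, so the inner integral is finite almost
everywhere. -/
theorem ae_integrable_scatter_integrand (hf : IsScatteringKernel f) {φ : Space d × Dir d → ℝ}
    (hφ : Integrable φ (phaseMeasure Ω)) :
    ∀ᵐ z ∂(phaseMeasure Ω),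
      Integrable (fun θ => f z.2 θ * φ (z.1, θ)) (angularMeasure d) := by
  set φ' := hφ.aestronglyMeasurable.mk φ with hφ'
  have hm : Measurable φ' := hφ.aestronglyMeasurable.stronglyMeasurable_mk.measurable
  have heq : φ =ᵐ[phaseMeasure Ω] φ' := hφ.aestronglyMeasurable.ae_eq_mk
  have hmn : Measurable fun z => ‖φ' z‖ₑ := hm.enorm
  have hfin : ∫⁻ z, ∫⁻ θ, ENNReal.ofReal (f z.2 θ) * ‖φ' (z.1, θ)‖ₑ ∂(angularMeasure d)
      ∂(phaseMeasure Ω) ≠ ∞ := by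
    rw [lintegral_lintegral_scatter hf hmn]
    exact ((hφ.congr heq).2).ne
  have hlt := ae_lt_top (measurable_scatter_integrand hf hmn).lintegral_prod_right' hfin
  filter_upwards [hlt, ae_ae_phaseMeasure heq] with z hz hz'
  have h1 : Integrable (fun θ => f z.2 θ * φ' (z.1, θ)) (angularMeasure d) := by
    refine ⟨Measurable.aestronglyMeasurable ?_, ?_⟩
    · exact (hf.measurable.comp measurable_prodMk_left).mul (hm.comp measurable_prodMk_left)
    · unfold HasFiniteIntegral
      simp_rw [enorm_scatter_integrand hf]
      exact hz
  refine h1.congr ?_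
  filter_upwards [hz'] with θ hθ
  rw [hθ]

theorem integrable_scatter (hf : IsScatteringKernel f) {φ : Space d × Dir d → ℝ}
    (hφ : Integrable φ (phaseMeasure Ω)) : Integrable (scatter f φ) (phaseMeasure Ω) := by
  set φ' := hφ.aestronglyMeasurable.mk φ with hφ'
  have hm : Measurable φ' := hφ.aestronglyMeasurable.stronglyMeasurable_mk.measurable
  have heq : φ =ᵐ[phaseMeasure Ω] φ' := hφ.aestronglyMeasurable.ae_eq_mk
  refine Integrable.congr ?_ (scatter_congr_ae heq).symm
  refine ⟨(stronglyMeasurable_scatter hf hm).aestronglyMeasurable, ?_⟩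
  have h2 := lintegral_lintegral_scatter (Ω := Ω) hf (g := fun z => ‖φ' z‖ₑ) hm.enorm
  refine lt_of_le_of_lt ?_ (h2.trans_lt (hφ.congr heq).2)
  refine lintegral_mono fun z => ?_
  simp_rw [← enorm_scatter_integrand hf]
  exact enorm_integral_le_lintegral_enorm _

theorem scatter_sub (hf : IsScatteringKernel f) {φ ψ : Space d × Dir d → ℝ}
    (hφ : Integrable φ (phaseMeasure Ω)) (hψ : Integrable ψ (phaseMeasure Ω)) :
    ∀ᵐ z ∂(phaseMeasure Ω), scatter f (fun y => φ y - ψ y) z = scatter f φ z - scatter f ψ z := by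
  filter_upwards [ae_integrable_scatter_integrand hf hφ, ae_integrable_scatter_integrand hf hψ]
    with z h1 h2
  unfold scatter
  rw [← integral_sub h1 h2]
  simp_rw [mul_sub]

theorem scatter_nonneg (hf : IsScatteringKernel f) {φ : Space d × Dir d → ℝ}
    (hφ : ∀ᵐ z ∂(phaseMeasure Ω), 0 ≤ φ z) : ∀ᵐ z ∂(phaseMeasure Ω), 0 ≤ scatter f φ z := by
  filter_upwards [ae_ae_phaseMeasure hφ] with z hz
  refine integral_nonneg_of_ae ?_
  filter_upwards [hz] with θ hθ
  exact mul_nonneg (hf.nonneg _ _) hθ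

/-- The part `(C - μa - μs) φ + μs K φ` of the transport equation. -/
def collision (f : Dir d → Dir d → ℝ) (μa μs : Space d → ℝ) (C : ℝ) (φ : Space d × Dir d → ℝ)
    (z : Space d × Dir d) : ℝ :=
  (C - μa z.1 - μs z.1) * φ z + μs z.1 * scatter f φ z

theorem IsCoeff.aestronglyMeasurable_phase {a b : ℝ} {μ : Space d → ℝ} (h : IsCoeff Ω a b μ) :
    AEStronglyMeasurable (fun z : Space d × Dir d => μ z.1) (phaseMeasure Ω) :=
  h.aestronglyMeasurable.comp_fst

theorem IsCoeff.bounds_phase {a b : ℝ} {μ : Space d → ℝ} (h : IsCoeff Ω a b μ) :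
    ∀ᵐ z ∂(phaseMeasure Ω), a ≤ μ z.1 ∧ μ z.1 ≤ b :=
  ae_phaseMeasure_of_ae h.bounds

theorem IsCoeff.integrable_mul {a b : ℝ} {μ : Space d → ℝ} (h : IsCoeff Ω a b μ)
    {φ : Space d × Dir d → ℝ} (hφ : Integrable φ (phaseMeasure Ω)) :
    Integrable (fun z => μ z.1 * φ z) (phaseMeasure Ω) := by
  refine hφ.bdd_mul (c := max |a| |b|) h.aestronglyMeasurable_phase ?_
  filter_upwards [h.bounds_phase] with z hz
  exact abs_le_max_abs_abs hz.1 hz.2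

theorem integrable_collision (hf : IsScatteringKernel f) {μa μs : Space d → ℝ} {a b a' b' : ℝ}
    (hμa : IsCoeff Ω a b μa) (hμs : IsCoeff Ω a' b' μs) (C : ℝ) {φ : Space d × Dir d → ℝ}
    (hφ : Integrable φ (phaseMeasure Ω)) :
    Integrable (collision f μa μs C φ) (phaseMeasure Ω) := by
  have h := (((hφ.const_mul C).sub (hμa.integrable_mul hφ)).sub (hμs.integrable_mul hφ)).add
    (hμs.integrable_mul (integrable_scatter hf hφ))
  refine h.congr (ae_of_all _ fun z => ?_)
  simp only [collision, Pi.add_apply, Pi.sub_apply]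
  ring

end Scatter

/-! ### Duhamel's formula for the transport equation -/

theorem ae_integrableOn_flow {Ω : Set (Space d)} (ho : IsOpen Ω) (hb : Bornology.IsBounded Ω)
    (hc : Convex ℝ Ω) {G : Space d × Dir d → ℝ} (hG : Integrable G (phaseMeasure Ω)) :
    ∀ᵐ z ∂(phaseMeasure Ω),
      IntegrableOn (fun t => G (flow z t)) (Ioo (-backTime Ω z) 0) := by
  set G' := hG.aestronglyMeasurable.mk G with hG'
  have hm : Measurable G' := hG.aestronglyMeasurable.stronglyMeasurable_mk.measurable
  have heq : ∀ᵐ z ∂(phaseMeasure Ω), G z = G' z := hG.aestronglyMeasurable.ae_eq_mk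
  have hfin : ∫⁻ z, ‖G' z‖ₑ ∂(phaseMeasure Ω) ≠ ∞ := (hG.congr heq).2.ne
  filter_upwards [ae_phaseMeasure_mem ho.measurableSet,
    ae_phaseMeasure_of_full (ae_ae_flow_mem ho.measurableSet heq),
    ae_phaseMeasure_of_full (ae_lintegral_flow_lt_top ho.measurableSet hm.enorm.aemeasurable hfin)]
    with z hz h1 h2
  obtain ⟨n, hn⟩ := exists_nat_ge (backTime Ω z)
  have hsub : Ioo (-backTime Ω z) 0 ⊆ Icc (-n : ℝ) n := fun t ht =>
    ⟨by linarith [ht.1], by have : (0 : ℝ) ≤ n := n.cast_nonneg; linarith [ht.2]⟩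
  have hmem : ∀ t ∈ Ioo (-backTime Ω z) 0, (flow z t).1 ∈ Ω := fun t ht =>
    (flow_mem_iff_of_nonpos ho hb hc hz ht.2.le).2 ht.1
  have h3 : IntegrableOn (fun t => G' (flow z t)) (Ioo (-backTime Ω z) 0) := by
    refine ⟨(hm.comp (measurable_flow_right z)).aestronglyMeasurable, ?_⟩
    refine lt_of_le_of_lt ?_ (h2 n)
    refine le_trans ?_ (lintegral_mono_set hsub)
    refine setLIntegral_mono' measurableSet_Ioo fun t ht => ?_
    rw [indicator_of_mem (show flow z t ∈ (Prod.fst ⁻¹' Ω : Set _) from hmem t ht)]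
  refine h3.congr ?_
  filter_upwards [ae_restrict_of_ae h1, ae_restrict_mem measurableSet_Ioo] with t ht htm
  exact (ht (hmem t htm)).symm

/-- The representative `u` equals `φ` at almost every `z`, which settles the left side, and at
almost every time of almost every line, which is enough under the integral. -/
theorem IsRTESolution.ae_eq_duhamel {Ω : Set (Space d)} {f : Dir d → Dir d → ℝ} {p : ℝ≥0∞}
    {μa μs : Space d → ℝ} {q qb φ : Space d × Dir d → ℝ} (h : IsRTESolution Ω f p μa μs q qb φ)
    (ho : IsOpen Ω) (hb : Bornology.IsBounded Ω) (hc : Convex ℝ Ω) (C : ℝ)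
    (hG : Integrable (fun z => q z + collision f μa μs C φ z) (phaseMeasure Ω)) :
    ∀ᵐ z ∂(phaseMeasure Ω), φ z = Real.exp (-(C * backTime Ω z)) * inflowExt Ω qb z
      + ∫ t in Ioo (-backTime Ω z) 0, Real.exp (C * t)
        * (q (flow z t) + collision f μa μs C φ (flow z t)) := by
  obtain ⟨u, huφ, hu⟩ := h.exists_rep
  have hsc := scatter_congr_ae (f := f) huφ
  have hcomb : ∀ᵐ z ∂(phaseMeasure Ω), u z = φ z ∧ scatter f u z = scatter f φ z :=
    huφ.and hsc
  filter_upwards [ae_phaseMeasure_mem ho.measurableSet, huφ, hu,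
    ae_phaseMeasure_of_full (ae_ae_flow_mem ho.measurableSet hcomb),
    ae_integrableOn_flow ho hb hc hG] with z hz hzu hzs hzl hzi
  obtain ⟨hac, hder, hlim⟩ := hzs
  have hmem : ∀ t ∈ Ioc (-backTime Ω z) 0, (flow z t).1 ∈ Ω := fun t ht =>
    (flow_mem_iff_of_nonpos ho hb hc hz ht.2).2 ht.1
  have hD := duhamel_of_hasDerivAt (v := fun t => u (flow z t))
    (g := fun t => q (flow z t) + collision f μa μs C φ (flow z t)) (C := C)
    (backTime_pos ho hb hc hz)
    (fun a ha => hac a 0 ha.2.le fun t ht => hmem t ⟨lt_of_lt_of_le ha.1 ht.1, ht.2⟩)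
    (by
      filter_upwards [hder, hzl] with t h1 h2 htm
      have htΩ := hmem t ⟨htm.1, htm.2.le⟩
      obtain ⟨e1, e2⟩ := h2 htΩ
      refine (h1 htΩ).congr_deriv ?_
      rw [collision, e2, e1]
      ring) hzi hlim
  simp only [flow_zero] at hD
  rw [← hzu]
  exact hD

/-! ### The maximum principle -/

/-- No integrability is needed: the integral of a nonintegrable function is `0` by convention. -/
theorem ofReal_integral_le_lintegral {α : Type*} [MeasurableSpace α] {m : Measure α}
    (F : α → ℝ) : ENNReal.ofReal (∫ x, F x ∂m) ≤ ∫⁻ x, ENNReal.ofReal (F x) ∂m := by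
  by_cases hF : Integrable F m
  · rw [integral_eq_lintegral_pos_part_sub_lintegral_neg_part hF]
    refine (ENNReal.ofReal_le_ofReal (sub_le_self _ ENNReal.toReal_nonneg)).trans ?_
    exact ENNReal.ofReal_toReal_le
  · rw [integral_undef hF]
    simp

/-- Dropping the nonnegative `J` and `r`, the negative part `n` of `w` satisfies `n ≤ L H n`.
Integration gives `C ∫ n ≤ (C - a) ∫ n`, and since `∫ n` is finite and `a > 0`, it is zero. The
condition `b + b' ≤ C` makes `H` positive. -/
theorem nonneg_of_duhamel {Ω : Set (Space d)} (ho : IsOpen Ω) (hb : Bornology.IsBounded Ω)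
    (hc : Convex ℝ Ω) {f : Dir d → Dir d → ℝ} (hf : IsScatteringKernel f) {μa μs : Space d → ℝ}
    {a b b' C : ℝ} (hμa : IsCoeff Ω a b μa) (hμs : IsCoeff Ω 0 b' μs) (ha : 0 < a)
    (hC : b + b' ≤ C) (haC : a < C) {w r J : Space d × Dir d → ℝ}
    (hw : Integrable w (phaseMeasure Ω)) (hr : ∀ᵐ z ∂(phaseMeasure Ω), 0 ≤ r z)
    (hJ : ∀ᵐ z ∂(phaseMeasure Ω), 0 ≤ J z)
    (h : ∀ᵐ z ∂(phaseMeasure Ω), w z = J z + ∫ t in Ioo (-backTime Ω z) 0,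
      Real.exp (C * t) * (r (flow z t) + collision f μa μs C w (flow z t))) :
    ∀ᵐ z ∂(phaseMeasure Ω), 0 ≤ w z := by
  have hΩ := ho.measurableSet
  have hC0 : 0 < C := ha.trans haC
  set w' := hw.aestronglyMeasurable.mk w with hw'
  have hwm : Measurable w' := hw.aestronglyMeasurable.stronglyMeasurable_mk.measurable
  have hww : w =ᵐ[phaseMeasure Ω] w' := hw.aestronglyMeasurable.ae_eq_mk
  set μa' := hμa.aestronglyMeasurable.mk μa with hμa'
  have hμam : Measurable μa' := hμa.aestronglyMeasurable.stronglyMeasurable_mk.measurable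
  have hμae : ∀ᵐ z ∂(phaseMeasure Ω), μa z.1 = μa' z.1 :=
    ae_phaseMeasure_of_ae hμa.aestronglyMeasurable.ae_eq_mk
  set μs' := hμs.aestronglyMeasurable.mk μs with hμs'
  have hμsm : Measurable μs' := hμs.aestronglyMeasurable.stronglyMeasurable_mk.measurable
  have hμse : ∀ᵐ z ∂(phaseMeasure Ω), μs z.1 = μs' z.1 :=
    ae_phaseMeasure_of_ae hμs.aestronglyMeasurable.ae_eq_mk
  set α : Space d → ℝ≥0∞ := fun x => ENNReal.ofReal (C - μa' x - μs' x) with hα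
  set β : Space d → ℝ≥0∞ := fun x => ENNReal.ofReal (μs' x) with hβ
  have hαm : Measurable α := by fun_prop
  have hβm : Measurable β := by fun_prop
  set n : Space d × Dir d → ℝ≥0∞ := fun z => ENNReal.ofReal (-w' z) with hn
  have hnm : Measurable n := by fun_prop
  -- By positivity of `H`, the negative part of `H w` is at most `H` applied to the negative part of
  -- `w`.
  have hG : ∀ᵐ z ∂(phaseMeasure Ω),
      ENNReal.ofReal (-(r z + collision f μa μs C w z)) ≤ coll f α β n z := by
    filter_upwards [hr, hww, scatter_congr_ae (f := f) hww, hμae, hμse, hμa.bounds_phase,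
      hμs.bounds_phase] with z h1 h2 h3 h4 h5 h6 h7
    have e1 : -(r z + collision f μa μs C w z)
        ≤ (C - μa' z.1 - μs' z.1) * (-w' z) + μs' z.1 * (-scatter f w' z) := by
      rw [collision, h2, h3, h4, h5]
      linarith
    refine (ENNReal.ofReal_le_ofReal e1).trans (ENNReal.ofReal_add_le.trans ?_)
    rw [ENNReal.ofReal_mul (by rw [← h4, ← h5]; linarith),
      ENNReal.ofReal_mul (by rw [← h5]; exact h7.1)]
    unfold coll
    gcongr
    rw [scatter, ← integral_neg]
    refine (ofReal_integral_le_lintegral _).trans (lintegral_mono fun θ => ?_)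
    dsimp only
    rw [← mul_neg, ENNReal.ofReal_mul (hf.nonneg _ _)]
  have hle : ∀ᵐ z ∂(phaseMeasure Ω), n z ≤ lineInt C Ω (coll f α β n) z := by
    filter_upwards [h, hJ, hww, ae_phaseMeasure_mem hΩ,
      ae_phaseMeasure_of_full (ae_ae_flow_mem hΩ hG)] with z h1 h2 h3 hz h4
    have e1 : -w' z ≤ ∫ t in Ioo (-backTime Ω z) 0,
        -(Real.exp (C * t) * (r (flow z t) + collision f μa μs C w (flow z t))) := by
      rw [integral_neg, ← h3, h1]
      linarith
    refine (ENNReal.ofReal_le_ofReal e1).trans ((ofReal_integral_le_lintegral _).trans ?_)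
    rw [lineInt_eq_setLIntegral_Ioo ho hb hc C _ hz]
    refine lintegral_mono_ae ?_
    filter_upwards [ae_restrict_of_ae h4, ae_restrict_mem measurableSet_Ioo] with t ht htm
    rw [← mul_neg, ENNReal.ofReal_mul (Real.exp_pos _).le]
    gcongr
    exact ht ((flow_mem_iff_of_nonpos ho hb hc hz htm.2.le).2 htm.1)
  set N := ∫⁻ z, n z ∂(phaseMeasure Ω) with hN
  have hNfin : N ≠ ∞ := by
    refine ne_top_of_le_ne_top (hw.congr hww).2.ne (lintegral_mono fun z => ?_)
    rw [← ofReal_norm, Real.norm_eq_abs]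
    exact ENNReal.ofReal_le_ofReal (neg_le_abs _)
  have h1 : ENNReal.ofReal C * N ≤ ENNReal.ofReal (C - a) * N := by
    calc ENNReal.ofReal C * N
        ≤ ENNReal.ofReal C * ∫⁻ z, lineInt C Ω (coll f α β n) z ∂(phaseMeasure Ω) := by
          gcongr 1
          exact lintegral_mono_ae hle
      _ ≤ ∫⁻ z, coll f α β n z ∂(phaseMeasure Ω) :=
          lintegral_lineInt_le hC0 hΩ (measurable_coll hf hαm hβm hnm).aemeasurable
      _ = ∫⁻ z, (α z.1 + β z.1) * n z ∂(phaseMeasure Ω) := lintegral_coll hf Ω hαm hβm hnm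
      _ ≤ ∫⁻ z, ENNReal.ofReal (C - a) * n z ∂(phaseMeasure Ω) := by
          refine lintegral_mono_ae ?_
          filter_upwards [hμae, hμse, hμa.bounds_phase, hμs.bounds_phase] with z h4 h5 h6 h7
          gcongr
          simp only [hα, hβ]
          rw [← h4, ← h5, ← ENNReal.ofReal_add (by linarith) h7.1]
          exact ENNReal.ofReal_le_ofReal (by linarith)
      _ = ENNReal.ofReal (C - a) * N := lintegral_const_mul' _ _ ENNReal.ofReal_ne_top
  have h2 : N = 0 := by
    have e : ENNReal.ofReal C = ENNReal.ofReal a + ENNReal.ofReal (C - a) := by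
      rw [← ENNReal.ofReal_add ha.le (by linarith)]; congr 1; ring
    rw [e, add_mul] at h1
    have h3 : ENNReal.ofReal a * N = 0 := by
      have hne : ENNReal.ofReal (C - a) * N ≠ ∞ := ENNReal.mul_ne_top ENNReal.ofReal_ne_top hNfin
      have h4 : ENNReal.ofReal a * N + ENNReal.ofReal (C - a) * N
          ≤ 0 + ENNReal.ofReal (C - a) * N := by rwa [zero_add]
      exact nonpos_iff_eq_zero.1 ((ENNReal.add_le_add_iff_right hne).1 h4)
    rcases mul_eq_zero.1 h3 with h5 | h5
    · exact absurd h5 (by simpa using ha)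
    · exact h5
  rw [hN, lintegral_eq_zero_iff hnm] at h2
  filter_upwards [h2, hww] with z h3 h4
  rw [h4]
  simpa [hn] using h3

theorem collision_nonneg {Ω : Set (Space d)} {f : Dir d → Dir d → ℝ} (hf : IsScatteringKernel f)
    {μa μs : Space d → ℝ} {a b b' C : ℝ} (hμa : IsCoeff Ω a b μa) (hμs : IsCoeff Ω 0 b' μs)
    (hC : b + b' ≤ C) {w : Space d × Dir d → ℝ} (hw : ∀ᵐ z ∂(phaseMeasure Ω), 0 ≤ w z) :
    ∀ᵐ z ∂(phaseMeasure Ω), 0 ≤ collision f μa μs C w z := by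
  filter_upwards [hw, scatter_nonneg hf hw, hμa.bounds_phase, hμs.bounds_phase] with z h1 h2 h3 h4
  exact add_nonneg (mul_nonneg (by linarith) h1) (mul_nonneg h4.1 h2)

/-- The integral term in Duhamel's formula is nonnegative for nonnegative integrands, and positive
for positive ones. -/
theorem ae_duhamel_integral_nonneg {Ω : Set (Space d)} (ho : IsOpen Ω)
    (hb : Bornology.IsBounded Ω) (hc : Convex ℝ Ω) (C : ℝ) {G : Space d × Dir d → ℝ}
    (hG : ∀ᵐ z ∂(phaseMeasure Ω), 0 ≤ G z) :
    ∀ᵐ z ∂(phaseMeasure Ω),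
      0 ≤ ∫ t in Ioo (-backTime Ω z) 0, Real.exp (C * t) * G (flow z t) := by
  filter_upwards [ae_phaseMeasure_mem ho.measurableSet,
    ae_phaseMeasure_of_full (ae_ae_flow_mem ho.measurableSet hG)] with z hz h1
  refine integral_nonneg_of_ae ?_
  filter_upwards [ae_restrict_of_ae h1, ae_restrict_mem measurableSet_Ioo] with t ht htm
  exact mul_nonneg (Real.exp_pos _).le
    (ht ((flow_mem_iff_of_nonpos ho hb hc hz htm.2.le).2 htm.1))

theorem ae_duhamel_integral_pos {Ω : Set (Space d)} (ho : IsOpen Ω)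
    (hb : Bornology.IsBounded Ω) (hc : Convex ℝ Ω) (C : ℝ) {G : Space d × Dir d → ℝ}
    (hGi : Integrable G (phaseMeasure Ω)) (hG : ∀ᵐ z ∂(phaseMeasure Ω), 0 < G z) :
    ∀ᵐ z ∂(phaseMeasure Ω),
      0 < ∫ t in Ioo (-backTime Ω z) 0, Real.exp (C * t) * G (flow z t) := by
  filter_upwards [ae_phaseMeasure_mem ho.measurableSet, ae_integrableOn_flow ho hb hc hGi,
    ae_phaseMeasure_of_full (ae_ae_flow_mem ho.measurableSet hG)] with z hz hi h1
  have hpos : ∀ᵐ t ∂(volume.restrict (Ioo (-backTime Ω z) 0)),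
      0 < Real.exp (C * t) * G (flow z t) := by
    filter_upwards [ae_restrict_of_ae h1, ae_restrict_mem measurableSet_Ioo] with t ht htm
    exact mul_pos (Real.exp_pos _)
      (ht ((flow_mem_iff_of_nonpos ho hb hc hz htm.2.le).2 htm.1))
  rw [integral_pos_iff_support_of_nonneg_ae (hpos.mono fun t ht => ht.le)
    (integrableOn_exp_mul hi)]
  have h2 : volume.restrict (Ioo (-backTime Ω z) 0)
      (Function.support fun t => Real.exp (C * t) * G (flow z t))
      = volume.restrict (Ioo (-backTime Ω z) 0) univ := by
    refine measure_congr ?_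
    filter_upwards [hpos] with t ht
    exact propext (iff_of_true ht.ne' trivial)
  rw [h2, Measure.restrict_apply_univ, Real.volume_Ioo]
  simpa using backTime_pos ho hb hc hz

/-! ### Existence of solutions -/

section Existence

variable {Ω : Set (Space d)} {f : Dir d → Dir d → ℝ}

/-- On `Ω` the backward chord length is the undamped line integral of `1`, whose measurability comes
from Tonelli. -/
theorem aestronglyMeasurable_backTime (ho : IsOpen Ω) (hb : Bornology.IsBounded Ω)
    (hc : Convex ℝ Ω) : AEStronglyMeasurable (backTime Ω) (phaseMeasure Ω) := by
  refine ⟨fun z => (lineInt 0 Ω (fun _ => 1) z).toReal,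
    (measurable_lineInt ho.measurableSet measurable_const).ennreal_toReal.stronglyMeasurable, ?_⟩
  filter_upwards [ae_phaseMeasure_mem ho.measurableSet] with z hz
  rw [lineInt_eq_setLIntegral_Ioo ho hb hc 0 _ hz]
  simp [(backTime_pos ho hb hc hz).le]

/-- The coefficients obey their bounds only almost everywhere, whereas `isSubMarkov_coll` asks for
`α + β ≤ D` at every point. Truncation provides this and changes nothing almost everywhere, because
`C - μa ≤ C - a = D`. -/
theorem exists_measurable_bounded_coeff {μa μs : Space d → ℝ} {a b b' C D : ℝ}
    (hμa : IsCoeff Ω a b μa) (hμs : IsCoeff Ω 0 b' μs) (hCD : C = a + D) (hb' : b' ≤ D) :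
    ∃ α β : Space d → ℝ≥0∞, Measurable α ∧ Measurable β ∧
      (∀ x, α x + β x ≤ ENNReal.ofReal D) ∧
      ∀ᵐ x ∂(volume.restrict Ω), α x = ENNReal.ofReal (C - μa x - μs x) ∧
        β x = ENNReal.ofReal (μs x) := by
  set μa' := hμa.aestronglyMeasurable.mk μa with hμa'
  have hμam : Measurable μa' := hμa.aestronglyMeasurable.stronglyMeasurable_mk.measurable
  have hμae : ∀ᵐ x ∂(volume.restrict Ω), μa x = μa' x := hμa.aestronglyMeasurable.ae_eq_mk
  set μs' := hμs.aestronglyMeasurable.mk μs with hμs'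
  have hμsm : Measurable μs' := hμs.aestronglyMeasurable.stronglyMeasurable_mk.measurable
  have hμse : ∀ᵐ x ∂(volume.restrict Ω), μs x = μs' x := hμs.aestronglyMeasurable.ae_eq_mk
  set β : Space d → ℝ≥0∞ := fun x => min (ENNReal.ofReal (μs' x)) (ENNReal.ofReal D) with hβ
  have hβm : Measurable β := by fun_prop
  refine ⟨fun x => min (ENNReal.ofReal (C - μa' x - μs' x)) (ENNReal.ofReal D - β x), β, ?_, hβm,
    fun x => ?_, ?_⟩
  · exact Measurable.min (by fun_prop) (hβm.const_sub _)
  · calc _ ≤ (ENNReal.ofReal D - β x) + β x := by gcongr; exact min_le_right _ _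
      _ = _ := tsub_add_cancel_of_le (min_le_right _ _)
  · filter_upwards [hμae, hμse, hμa.bounds, hμs.bounds] with x h1 h2 h3 h4
    have e : β x = ENNReal.ofReal (μs x) := by
      simp only [hβ, ← h2]
      exact min_eq_left (ENNReal.ofReal_le_ofReal (by linarith))
    refine ⟨?_, e⟩
    rw [e, ← h1, ← h2, ← ENNReal.ofReal_sub _ h4.1]
    exact min_eq_left (ENNReal.ofReal_le_ofReal (by linarith))

theorem scatter_toReal (hf : IsScatteringKernel f) {Φ : Space d × Dir d → ℝ≥0∞}
    (hΦ : Measurable Φ) (hfin : ∀ᵐ z ∂(phaseMeasure Ω), Φ z ≠ ∞) :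
    ∀ᵐ z ∂(phaseMeasure Ω), scatter f (fun y => (Φ y).toReal) z
      = (∫⁻ θ, ENNReal.ofReal (f z.2 θ) * Φ (z.1, θ) ∂(angularMeasure d)).toReal := by
  filter_upwards [ae_ae_phaseMeasure hfin] with z hz
  unfold scatter
  rw [integral_eq_lintegral_of_nonneg_ae]
  · congr 1
    refine lintegral_congr_ae ?_
    filter_upwards [hz] with θ hθ
    rw [ENNReal.ofReal_mul (hf.nonneg _ _), ENNReal.ofReal_toReal hθ]
  · exact ae_of_all _ fun θ => mul_nonneg (hf.nonneg _ _) ENNReal.toReal_nonneg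
  · exact ((hf.measurable.comp measurable_prodMk_left).mul
      (hΦ.comp measurable_prodMk_left).ennreal_toReal).aestronglyMeasurable

theorem locallyIntegrable_toReal {F : ℝ → ℝ≥0∞} (hF : Measurable F)
    (h : ∀ n : ℕ, ∫⁻ t in Icc (-n : ℝ) n, F t < ∞) : LocallyIntegrable fun t => (F t).toReal := by
  intro x
  obtain ⟨n, hn⟩ := exists_nat_gt |x|
  rw [abs_lt] at hn
  refine ⟨Icc (-n : ℝ) n, Icc_mem_nhds hn.1 hn.2, hF.ennreal_toReal.aestronglyMeasurable, ?_⟩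
  refine lt_of_le_of_lt (lintegral_mono fun t => ?_) (h n)
  rw [← ofReal_norm, Real.norm_of_nonneg ENNReal.toReal_nonneg]
  exact ENNReal.ofReal_toReal_le

theorem memLp_toReal {α : Type*} [MeasurableSpace α] {m : Measure α} {p : ℝ≥0∞}
    {g : α → ℝ≥0∞} (hg : Measurable g) (h : eLpNorm g p m < ∞) :
    MemLp (fun z => (g z).toReal) p m :=
  ⟨hg.ennreal_toReal.aestronglyMeasurable,
    lt_of_le_of_lt (eLpNorm_mono_enorm fun z => by
      rw [← ofReal_norm, Real.norm_of_nonneg ENNReal.toReal_nonneg]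
      exact ENNReal.ofReal_toReal_le) h⟩

theorem eLpNorm_ofReal_lt_top {α : Type*} [MeasurableSpace α] {m : Measure α} {p : ℝ≥0∞}
    {g g' : α → ℝ} (hg : MemLp g p m) (h : g =ᵐ[m] g') :
    eLpNorm (fun z => ENNReal.ofReal (g' z)) p m < ∞ := by
  refine lt_of_le_of_lt (eLpNorm_mono_enorm_ae ?_) hg.2
  filter_upwards [h] with z hz
  rw [hz, enorm_eq_self, ← ofReal_norm]
  exact ENNReal.ofReal_le_ofReal (le_abs_self _)

/-- The solution is `J + ψ`: the unscattered inflow `J`, and the fixed point `ψ = L (q + H J + H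
ψ)`. The converse of Duhamel's formula then recovers the differential equation on each line. -/
theorem exists_isRTESolution (ho : IsOpen Ω) (hb : Bornology.IsBounded Ω) (hc : Convex ℝ Ω)
    (hf : IsScatteringKernel f) {p : ℝ≥0∞} (hp : 1 ≤ p) {μa μs : Space d → ℝ} {a b b' : ℝ}
    (hμa : IsCoeff Ω a b μa) (hμs : IsCoeff Ω 0 b' μs) (ha : 0 < a)
    {q qb : Space d × Dir d → ℝ} (hq : MemLp q p (phaseMeasure Ω))
    (hq0 : ∀ᵐ z ∂(phaseMeasure Ω), 0 ≤ q z)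
    (hqb : MemLp (inflowExt Ω qb) p (phaseMeasure Ω))
    (hqb0 : ∀ᵐ z ∂(phaseMeasure Ω), 0 ≤ inflowExt Ω qb z) :
    ∃ φ, IsRTESolution Ω f p μa μs q qb φ := by
  have hΩ := ho.measurableSet
  have : IsFiniteMeasure (phaseMeasure Ω) := isFiniteMeasure_phaseMeasure hb
  -- Large enough that `C - μa - μs` is nonnegative and `μs ≤ D`.
  set D : ℝ := |b| + |b'| + 1 with hDdef
  have hbabs := le_abs_self b
  have hb'abs := le_abs_self b'
  have hD : 0 < D := by positivity
  set C : ℝ := a + D with hCdef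
  have hC : 0 < C := by positivity
  obtain ⟨α, β, hα, hβ, hαβ, hae⟩ := exists_measurable_bounded_coeff hμa hμs hCdef
    (by linarith [abs_nonneg b])
  -- the free-streaming part
  set J : Space d × Dir d → ℝ := fun z => Real.exp (-(C * backTime Ω z)) * inflowExt Ω qb z
    with hJdef
  have hτ0 : ∀ᵐ z ∂(phaseMeasure Ω), 0 ≤ backTime Ω z := by
    filter_upwards [ae_phaseMeasure_mem hΩ] with z hz using (backTime_pos ho hb hc hz).le
  have hJ0 : ∀ᵐ z ∂(phaseMeasure Ω), 0 ≤ J z := by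
    filter_upwards [hqb0] with z hz using mul_nonneg (Real.exp_pos _).le hz
  have hJp : MemLp J p (phaseMeasure Ω) := by
    refine hqb.of_le ?_ ?_
    · refine AEStronglyMeasurable.mul ?_ hqb.1
      exact Real.continuous_exp.comp_aestronglyMeasurable
        ((aestronglyMeasurable_backTime ho hb hc).const_mul C).neg
    · filter_upwards [hτ0] with z hz
      rw [hJdef, norm_mul, Real.norm_of_nonneg (Real.exp_pos _).le]
      refine mul_le_of_le_one_left (norm_nonneg _) (Real.exp_le_one_iff.2 ?_)
      have := mul_nonneg hC.le hz
      linarith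
  set J' := hJp.1.mk J with hJ'
  have hJ'm : Measurable fun z => ENNReal.ofReal (J' z) :=
    hJp.1.stronglyMeasurable_mk.measurable.ennreal_ofReal
  have hJe : J =ᵐ[phaseMeasure Ω] J' := hJp.1.ae_eq_mk
  set q' := hq.1.mk q with hq'
  have hq'm : Measurable fun z => ENNReal.ofReal (q' z) :=
    hq.1.stronglyMeasurable_mk.measurable.ennreal_ofReal
  have hqe : q =ᵐ[phaseMeasure Ω] q' := hq.1.ae_eq_mk
  -- the scattered part
  set r : Space d × Dir d → ℝ≥0∞ :=
    fun z => ENNReal.ofReal (q' z) + coll f α β (fun y => ENNReal.ofReal (J' y)) z with hr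
  have hrm : Measurable r := hq'm.add (measurable_coll hf hα hβ hJ'm)
  -- Used with `s = p` for membership in `L^p` and with `s = 1` for integrability along lines.
  have hrp : ∀ s : ℝ≥0∞, 1 ≤ s → s ≤ p → eLpNorm r s (phaseMeasure Ω) < ∞ := by
    intro s hs hsp
    refine (eLpNorm_add_le hq'm.aestronglyMeasurable
      (measurable_coll hf hα hβ hJ'm).aestronglyMeasurable hs).trans_lt ?_
    refine ENNReal.add_lt_top.2 ⟨eLpNorm_ofReal_lt_top (hq.mono_exponent hsp) hqe, ?_⟩
    refine (eLpNorm_coll_le hf Ω hα hβ hD hαβ hs hJ'm).trans_lt ?_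
    exact ENNReal.mul_lt_top ENNReal.ofReal_lt_top
      (eLpNorm_ofReal_lt_top (hJp.mono_exponent hsp) hJe)
  obtain ⟨ψ, hψm, hψ, hψp⟩ := exists_fixedPoint_lineInt_coll hΩ hf hα hβ ha hD hαβ hrm
  have hψlt : ∀ s : ℝ≥0∞, 1 ≤ s → s ≤ p → eLpNorm ψ s (phaseMeasure Ω) < ∞ := fun s hs hsp =>
    (hψp s hs).trans_lt (ENNReal.mul_lt_top (by simpa using ha) (hrp s hs hsp))
  set Φ : Space d × Dir d → ℝ≥0∞ := fun z => ENNReal.ofReal (J' z) + ψ z with hΦ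
  have hΦm : Measurable Φ := hJ'm.add hψm
  have hΦ1 : ∫⁻ z, Φ z ∂(phaseMeasure Ω) < ∞ := by
    have h1 := eLpNorm_add_le (μ := phaseMeasure Ω) hJ'm.aestronglyMeasurable
      hψm.aestronglyMeasurable (le_refl (1 : ℝ≥0∞))
    have h2 := h1.trans_lt (ENNReal.add_lt_top.2
      ⟨eLpNorm_ofReal_lt_top (hJp.mono_exponent hp) hJe, hψlt 1 le_rfl hp⟩)
    simpa [eLpNorm_one_eq_lintegral_enorm] using h2
  have hΦfin : ∀ᵐ z ∂(phaseMeasure Ω), Φ z ≠ ∞ :=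
    (ae_lt_top hΦm hΦ1.ne).mono fun z hz => hz.ne
  set G : Space d × Dir d → ℝ≥0∞ := fun z => r z + coll f α β ψ z with hG
  have hGm : Measurable G := hrm.add (measurable_coll hf hα hβ hψm)
  have hGeq : ∀ z, G z = ENNReal.ofReal (q' z) + coll f α β Φ z := fun z => by
    simp only [hG, hr, hΦ]
    rw [coll_add hf hJ'm, add_assoc]
  have hG1 : ∫⁻ z, G z ∂(phaseMeasure Ω) < ∞ := by
    have h1 := eLpNorm_add_le (μ := phaseMeasure Ω) hrm.aestronglyMeasurable
      (measurable_coll hf hα hβ hψm).aestronglyMeasurable (le_refl (1 : ℝ≥0∞))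
    have h2 := h1.trans_lt (ENNReal.add_lt_top.2 ⟨hrp 1 le_rfl hp,
      (eLpNorm_coll_le hf Ω hα hβ hD hαβ le_rfl hψm).trans_lt
        (ENNReal.mul_lt_top ENNReal.ofReal_lt_top (hψlt 1 le_rfl hp))⟩)
    simpa [eLpNorm_one_eq_lintegral_enorm] using h2
  have hGfin : ∀ᵐ z ∂(phaseMeasure Ω), G z ≠ ∞ :=
    (ae_lt_top hGm hG1.ne).mono fun z hz => hz.ne
  -- `J` itself, not its measurable modification `J'`: its formula holds at every point of a line in
  -- `Ω`, as does the equation for `ψ`, so `φ` serves as its own representative.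
  set φ : Space d × Dir d → ℝ := fun z => J z + (ψ z).toReal with hφ
  have hφΦ : φ =ᵐ[phaseMeasure Ω] fun z => (Φ z).toReal := by
    filter_upwards [hJe, hJ0, hΦfin] with z h1 h2 h3
    have h4 : ψ z ≠ ∞ := fun h => h3 (by simp [hΦ, h])
    rw [hφ, hΦ]
    dsimp only
    rw [ENNReal.toReal_add ENNReal.ofReal_ne_top h4, ENNReal.toReal_ofReal (h1 ▸ h2), h1]
  have hSfin : ∀ᵐ z ∂(phaseMeasure Ω),
      ∫⁻ θ, ENNReal.ofReal (f z.2 θ) * Φ (z.1, θ) ∂(angularMeasure d) ≠ ∞ := by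
    have h1 := lintegral_lintegral_scatter (Ω := Ω) hf hΦm
    exact (ae_lt_top (measurable_scatter_integrand hf hΦm).lintegral_prod_right'
      (by rw [h1]; exact hΦ1.ne)).mono fun z hz => hz.ne
  have hkey : ∀ᵐ z ∂(phaseMeasure Ω),
      (G z).toReal = q z + collision f μa μs C φ z ∧ G z ≠ ∞ := by
    filter_upwards [hφΦ, scatter_congr_ae (f := f) hφΦ, scatter_toReal hf hΦm hΦfin, hΦfin, hSfin,
      hqe, hq0, ae_phaseMeasure_of_ae hae, hμa.bounds_phase, hμs.bounds_phase, hGfin]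
      with z h1 h2 h3 h4 h5 h6 h7 h8 h9 h10 h11
    refine ⟨?_, h11⟩
    rw [collision, h1, h2, h3, hGeq, coll, h8.1, h8.2, ENNReal.toReal_add ENNReal.ofReal_ne_top,
      ENNReal.toReal_add, ENNReal.toReal_mul, ENNReal.toReal_mul, ENNReal.toReal_ofReal,
      ENNReal.toReal_ofReal, ENNReal.toReal_ofReal h10.1, ← h6]
    · linarith [abs_nonneg b, abs_nonneg b']
    · rw [← h6]; exact h7
    · exact ENNReal.mul_ne_top ENNReal.ofReal_ne_top h4
    · exact ENNReal.mul_ne_top ENNReal.ofReal_ne_top h5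
    · exact ENNReal.add_ne_top.2 ⟨ENNReal.mul_ne_top ENNReal.ofReal_ne_top h4,
        ENNReal.mul_ne_top ENNReal.ofReal_ne_top h5⟩
  refine ⟨φ, hJp.add (memLp_toReal hψm (hψlt p hp le_rfl)), φ, ae_eq_refl _, ?_⟩
  filter_upwards [ae_phaseMeasure_mem hΩ, ae_phaseMeasure_of_full (ae_ae_flow_mem hΩ hkey),
    ae_phaseMeasure_of_full (ae_lintegral_flow_lt_top hΩ hGm.aemeasurable hG1.ne)]
    with z hz hline hloc
  -- Extension by zero outside `Ω` gives a source that is locally integrable on all of `ℝ`, as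
  -- `hasDerivAt_of_duhamel` requires.
  set F : ℝ → ℝ≥0∞ := fun t => (Prod.fst ⁻¹' Ω).indicator G (flow z t) with hF
  have hFm : Measurable F :=
    (hGm.indicator (measurable_fst hΩ)).comp (measurable_flow_right z)
  have hg := locallyIntegrable_toReal hFm hloc
  have hFmem : ∀ t, (flow z t).1 ∈ Ω → F t = G (flow z t) := fun t ht =>
    indicator_of_mem (show flow z t ∈ (Prod.fst ⁻¹' Ω : Set _) from ht) _
  set τ := backTime Ω z with hτ
  have hτpos : 0 < τ := backTime_pos ho hb hc hz
  have hD1 := hasDerivAt_of_duhamel (v := fun t => φ (flow z t)) (T := τ) (C := C)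
    (v₀ := inflowExt Ω qb z) (isOpen_setOf_flow_mem ho z) hg (fun t ht => by
      have hτt : backTime Ω (flow z t) = τ + t := backTime_flow ho hb hc hz ht
      have hlt : -τ < t := (flow_mem_iff_of_le ho hb hc hz ht le_rfl).1 ht
      have e1 : J (flow z t) = Real.exp (-(C * (τ + t))) * inflowExt Ω qb z := by
        rw [hJdef]
        dsimp only
        rw [hτt, inflowExt_flow ho hb hc qb hz ht]
      have e2 : (ψ (flow z t)).toReal
          = ∫ s in Ioo (-(τ + t)) 0, Real.exp (C * s) * (F (t + s)).toReal := by
        rw [hψ, lineInt_eq_setLIntegral_Ioo ho hb hc _ _ ht, hτt,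
          integral_eq_lintegral_of_nonneg_ae]
        · congr 1
          refine lintegral_congr_ae ?_
          have h1 : ∀ᵐ s : ℝ, (flow z (t + s)).1 ∈ Ω → (G (flow z (t + s))).toReal
              = q (flow z (t + s)) + collision f μa μs C φ (flow z (t + s))
              ∧ G (flow z (t + s)) ≠ ∞ :=
            (measurePreserving_add_left volume t).quasiMeasurePreserving.ae hline
          filter_upwards [ae_restrict_of_ae h1, ae_restrict_mem measurableSet_Ioo] with s hs hsm
          have hmem : (flow z (t + s)).1 ∈ Ω :=
            (flow_mem_iff_of_le ho hb hc hz ht (by linarith [hsm.2])).2 (by linarith [hsm.1])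
          rw [ENNReal.ofReal_mul (Real.exp_pos _).le, hFmem _ hmem,
            ENNReal.ofReal_toReal (hs hmem).2, flow_flow]
        · exact ae_of_all _ fun s => mul_nonneg (Real.exp_pos _).le ENNReal.toReal_nonneg
        · exact Measurable.aestronglyMeasurable
            (by fun_prop : Measurable fun s : ℝ => Real.exp (C * s) * (F (t + s)).toReal)
      have e3 : ∫ s in Ioo (-(τ + t)) 0, Real.exp (C * s) * (F (t + s)).toReal
          = Real.exp (-(C * t)) * ∫ s in (-τ)..t, Real.exp (C * s) * (F s).toReal := by
        rw [← integral_Ioc_eq_integral_Ioo, ← intervalIntegral.integral_of_le (by linarith),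
          ← intervalIntegral.integral_const_mul]
        have h1 := intervalIntegral.integral_comp_add_left (a := -(τ + t)) (b := 0)
          (fun s => Real.exp (-(C * t)) * (Real.exp (C * s) * (F s).toReal)) t
        rw [show t + -(τ + t) = -τ by ring, add_zero] at h1
        rw [← h1]
        refine intervalIntegral.integral_congr fun s _ => ?_
        rw [← mul_assoc, ← Real.exp_add]
        congr 2
        ring
      simp only [hφ]
      rw [e1, e2, e3])
  refine ⟨fun s t hst hmem => hD1.1 s t hst hmem, ?_, hD1.2.2 ?_⟩
  · filter_upwards [hD1.2.1, hline] with t h1 h2 ht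
    refine (h1 ht).congr_deriv ?_
    rw [hFmem t ht, (h2 ht).1, collision]
    ring
  · filter_upwards [Ioo_mem_nhdsGT (show -τ < 0 by linarith)] with t ht
    exact (flow_mem_iff_of_nonpos ho hb hc hz ht.2.le).2 ht.1

end Existence

/-! ### Comparison of solutions -/

section Comparison

variable {Ω : Set (Space d)} {f : Dir d → Dir d → ℝ} {p : ℝ≥0∞} {μa μa₁ μa₂ μs : Space d → ℝ}
  {a b b' : ℝ} {q q₁ q₂ qb φ φ₁ φ₂ : Space d × Dir d → ℝ}

theorem IsRTESolution.integrable (h : IsRTESolution Ω f p μa μs q qb φ)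
    (hb : Bornology.IsBounded Ω) (hp : 1 ≤ p) : Integrable φ (phaseMeasure Ω) := by
  have := isFiniteMeasure_phaseMeasure hb
  exact h.memLp.integrable hp

/-- Once `φ ≥ 0` is known, the Duhamel integral is nonnegative, and strict positivity comes from the
damped inflow alone. -/
theorem IsRTESolution.nonneg (h : IsRTESolution Ω f p μa μs q qb φ) (ho : IsOpen Ω)
    (hb : Bornology.IsBounded Ω) (hc : Convex ℝ Ω) (hf : IsScatteringKernel f) (hp : 1 ≤ p)
    (hμa : IsCoeff Ω a b μa) (hμs : IsCoeff Ω 0 b' μs) (ha : 0 < a)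
    (hq : Integrable q (phaseMeasure Ω)) (hq0 : ∀ᵐ z ∂(phaseMeasure Ω), 0 ≤ q z)
    (hqb0 : ∀ᵐ z ∂(phaseMeasure Ω), 0 ≤ inflowExt Ω qb z) :
    (∀ᵐ z ∂(phaseMeasure Ω), 0 ≤ φ z) ∧
      ((∀ᵐ z ∂(phaseMeasure Ω), 0 < inflowExt Ω qb z) → ∀ᵐ z ∂(phaseMeasure Ω), 0 < φ z) := by
  set C : ℝ := |b| + |b'| + a + 1 with hC
  have h1 : b + b' ≤ C := by linarith [le_abs_self b, le_abs_self b']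
  have h2 : a < C := by linarith [abs_nonneg b, abs_nonneg b']
  have hφ := h.integrable hb hp
  have hD := h.ae_eq_duhamel ho hb hc C (hq.add (integrable_collision hf hμa hμs C hφ))
  have h0 : ∀ᵐ z ∂(phaseMeasure Ω), 0 ≤ φ z :=
    nonneg_of_duhamel ho hb hc hf hμa hμs ha h1 h2 hφ hq0
      (hqb0.mono fun z hz => mul_nonneg (Real.exp_pos _).le hz) hD
  refine ⟨h0, fun hpos => ?_⟩
  have hG : ∀ᵐ z ∂(phaseMeasure Ω), 0 ≤ q z + collision f μa μs C φ z := by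
    filter_upwards [hq0, collision_nonneg hf hμa hμs h1 h0] with z h3 h4 using add_nonneg h3 h4
  filter_upwards [hD, hpos, ae_duhamel_integral_nonneg ho hb hc C hG] with z h3 h4 h5
  rw [h3]
  exact add_pos_of_pos_of_nonneg (mul_pos (Real.exp_pos _) h4) h5

theorem collision_sub (hf : IsScatteringKernel f) (C : ℝ)
    (h₁ : Integrable φ₁ (phaseMeasure Ω)) (h₂ : Integrable φ₂ (phaseMeasure Ω)) :
    ∀ᵐ z ∂(phaseMeasure Ω), collision f μa₁ μs C φ₁ z - collision f μa₂ μs C φ₂ z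
      = (μa₂ z.1 - μa₁ z.1) * φ₂ z + collision f μa₁ μs C (fun y => φ₁ y - φ₂ y) z := by
  filter_upwards [scatter_sub hf h₁ h₂] with z hz
  simp only [collision, hz]
  ring

/-- The difference `φ₁ - φ₂` has zero inflow and satisfies Duhamel's formula for the coefficient
`μa₁` with source `q₁ - q₂ + (μa₂ - μa₁) φ₂`. The maximum principle gives the weak inequality; a
positive source then makes the Duhamel integral positive. -/
theorem IsRTESolution.le_and_lt (h₁ : IsRTESolution Ω f p μa₁ μs q₁ qb φ₁)
    (h₂ : IsRTESolution Ω f p μa₂ μs q₂ qb φ₂) (ho : IsOpen Ω)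
    (hb : Bornology.IsBounded Ω) (hc : Convex ℝ Ω) (hf : IsScatteringKernel f) (hp : 1 ≤ p)
    (hμa₁ : IsCoeff Ω a b μa₁) (hμa₂ : IsCoeff Ω a b μa₂) (hμs : IsCoeff Ω 0 b' μs) (ha : 0 < a)
    (hq₁ : Integrable q₁ (phaseMeasure Ω)) (hq₂ : Integrable q₂ (phaseMeasure Ω))
    (hr : ∀ᵐ z ∂(phaseMeasure Ω), 0 ≤ q₁ z - q₂ z + (μa₂ z.1 - μa₁ z.1) * φ₂ z) :
    (∀ᵐ z ∂(phaseMeasure Ω), φ₂ z ≤ φ₁ z) ∧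
      ((∀ᵐ z ∂(phaseMeasure Ω), 0 < q₁ z - q₂ z + (μa₂ z.1 - μa₁ z.1) * φ₂ z) →
        ∀ᵐ z ∂(phaseMeasure Ω), φ₂ z < φ₁ z) := by
  set C : ℝ := |b| + |b'| + a + 1 with hC
  have h1 : b + b' ≤ C := by linarith [le_abs_self b, le_abs_self b']
  have h2 : a < C := by linarith [abs_nonneg b, abs_nonneg b']
  have hφ₁ := h₁.integrable hb hp
  have hφ₂ := h₂.integrable hb hp
  have hG₁ : Integrable (fun z => q₁ z + collision f μa₁ μs C φ₁ z) (phaseMeasure Ω) :=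
    hq₁.add (integrable_collision hf hμa₁ hμs C hφ₁)
  have hG₂ : Integrable (fun z => q₂ z + collision f μa₂ μs C φ₂ z) (phaseMeasure Ω) :=
    hq₂.add (integrable_collision hf hμa₂ hμs C hφ₂)
  set w : Space d × Dir d → ℝ := fun z => φ₁ z - φ₂ z with hw
  set r : Space d × Dir d → ℝ := fun z => q₁ z - q₂ z + (μa₂ z.1 - μa₁ z.1) * φ₂ z with hrdef
  have hwi : Integrable w (phaseMeasure Ω) := hφ₁.sub hφ₂
  have hri : Integrable r (phaseMeasure Ω) := by
    refine ((hq₁.sub hq₂).add ((hμa₂.integrable_mul hφ₂).sub (hμa₁.integrable_mul hφ₂))).congr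
      (ae_of_all _ fun z => ?_)
    simp only [hrdef, Pi.add_apply, Pi.sub_apply]
    ring
  have hD : ∀ᵐ z ∂(phaseMeasure Ω), w z = 0 + ∫ t in Ioo (-backTime Ω z) 0,
      Real.exp (C * t) * (r (flow z t) + collision f μa₁ μs C w (flow z t)) := by
    filter_upwards [h₁.ae_eq_duhamel ho hb hc C hG₁, h₂.ae_eq_duhamel ho hb hc C hG₂,
      ae_integrableOn_flow ho hb hc hG₁, ae_integrableOn_flow ho hb hc hG₂,
      ae_phaseMeasure_mem ho.measurableSet, ae_phaseMeasure_of_full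
        (ae_ae_flow_mem ho.measurableSet (collision_sub (μa₁ := μa₁) (μa₂ := μa₂) (μs := μs)
          hf C hφ₁ hφ₂))] with z e1 e2 i1 i2 hz hl
    simp only [hw]
    rw [e1, e2, add_sub_add_left_eq_sub, zero_add,
      ← integral_sub (integrableOn_exp_mul i1) (integrableOn_exp_mul i2)]
    refine integral_congr_ae ?_
    filter_upwards [ae_restrict_of_ae hl, ae_restrict_mem measurableSet_Ioo] with t ht htm
    have := ht ((flow_mem_iff_of_nonpos ho hb hc hz htm.2.le).2 htm.1)
    simp only [hrdef]
    linear_combination Real.exp (C * t) * this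
  have h0 : ∀ᵐ z ∂(phaseMeasure Ω), 0 ≤ w z :=
    nonneg_of_duhamel ho hb hc hf hμa₁ hμs ha h1 h2 hwi hr (ae_of_all _ fun _ => le_rfl) hD
  refine ⟨h0.mono fun z hz => sub_nonneg.1 hz, fun hpos => ?_⟩
  have hG : ∀ᵐ z ∂(phaseMeasure Ω), 0 < r z + collision f μa₁ μs C w z := by
    filter_upwards [hpos, collision_nonneg hf hμa₁ hμs h1 h0] with z h3 h4
      using add_pos_of_pos_of_nonneg h3 h4
  filter_upwards [hD, ae_duhamel_integral_pos ho hb hc C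
    (hri.add (integrable_collision hf hμa₁ hμs C hwi)) hG] with z h3 h4
  rw [zero_add] at h3
  exact sub_pos.1 (h4.trans_eq h3.symm)

end Comparison

/-! ### Angular averages -/

section Angular

variable {Ω : Set (Space d)} {φ ψ : Space d × Dir d → ℝ}

theorem angularMeasure_ne_zero (hd : 0 < d) : angularMeasure d ≠ 0 := by
  have : NeZero d := ⟨hd.ne'⟩
  have : Nontrivial (Space d) := inferInstance
  obtain ⟨x, hx⟩ := NormedSpace.sphere_nonempty (x := (0 : Space d)) (r := 1) |>.2 zero_le_one
  intro h
  have h1 : (angularMeasure d) univ ≠ 0 := by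
    unfold angularMeasure
    exact (isOpen_univ.measure_pos _ ⟨⟨x, hx⟩, trivial⟩).ne'
  simp [h] at h1

theorem isScatteringKernel_const (hd : 0 < d) :
    IsScatteringKernel (d := d) fun _ _ => ((angularMeasure d).real univ)⁻¹ where
  measurable := measurable_const
  nonneg _ _ := by positivity
  symm _ _ := rfl
  integral_eq_one _ := by
    have : NeZero (angularMeasure d) := ⟨angularMeasure_ne_zero hd⟩
    rw [integral_const, smul_eq_mul, mul_inv_cancel₀]
    exact (measureReal_univ_pos).ne'

/-- Averaging is scattering with the isotropic kernel, so the `L^p` bound for `scatter` covers the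
emission source. -/
theorem angularMean_eq_scatter (φ : Space d × Dir d → ℝ) (z : Space d × Dir d) :
    angularMean φ z.1 = scatter (fun _ _ => ((angularMeasure d).real univ)⁻¹) φ z := by
  rw [angularMean, angularInt, scatter, integral_const_mul]

theorem memLp_scatter {f : Dir d → Dir d → ℝ} (hf : IsScatteringKernel f) {p : ℝ≥0∞}
    (hp : 1 ≤ p) (hφ : MemLp φ p (phaseMeasure Ω)) :
    MemLp (scatter f φ) p (phaseMeasure Ω) := by
  set φ' := hφ.1.mk φ with hφ'
  have hm : Measurable φ' := hφ.1.stronglyMeasurable_mk.measurable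
  have heq : φ =ᵐ[phaseMeasure Ω] φ' := hφ.1.ae_eq_mk
  refine (memLp_congr_ae (scatter_congr_ae heq)).2
    ⟨(stronglyMeasurable_scatter hf hm).aestronglyMeasurable, ?_⟩
  have h1 := eLpNorm_coll_le hf Ω (α := fun _ => 0) (β := fun _ => 1) measurable_const
    measurable_const one_pos (by simp) hp hm.enorm
  have h2 : eLpNorm (fun z => ‖φ' z‖ₑ) p (phaseMeasure Ω) < ∞ := by
    rw [eLpNorm_enorm]
    exact ((memLp_congr_ae heq).1 hφ).2
  refine lt_of_le_of_lt (eLpNorm_mono_enorm fun z => ?_)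
    (h1.trans_lt (ENNReal.mul_lt_top ENNReal.ofReal_lt_top h2))
  refine (enorm_integral_le_lintegral_enorm _).trans ?_
  simp_rw [enorm_scatter_integrand hf]
  simp [coll]

theorem memLp_emission_source (hd : 0 < d) {p : ℝ≥0∞} (hp : 1 ≤ p) {c₁ c₂ : ℝ}
    {η μ : Space d → ℝ} (hη : AEStronglyMeasurable η (volume.restrict Ω))
    (hηb : ∀ᵐ x ∂(volume.restrict Ω), 0 ≤ η x ∧ η x < 1) (hμ : IsCoeff Ω c₁ c₂ μ)
    (hφ : MemLp φ p (phaseMeasure Ω)) :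
    MemLp (fun z : Space d × Dir d => η z.1 * μ z.1 * angularMean φ z.1) p (phaseMeasure Ω) := by
  have h1 : MemLp (fun z : Space d × Dir d => angularMean φ z.1) p (phaseMeasure Ω) := by
    simp_rw [angularMean_eq_scatter]
    exact memLp_scatter (isScatteringKernel_const hd) hp hφ
  refine h1.of_le_mul (c := max |c₁| |c₂|)
    ((hη.comp_fst.mul hμ.aestronglyMeasurable_phase).mul h1.1) ?_
  filter_upwards [ae_phaseMeasure_of_ae hηb, hμ.bounds_phase] with z h2 h3
  rw [norm_mul, norm_mul]
  gcongr
  have h4 : ‖η z.1‖ ≤ 1 := by rw [Real.norm_of_nonneg h2.1]; exact h2.2.le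
  have h5 : ‖μ z.1‖ ≤ max |c₁| |c₂| := abs_le_max_abs_abs h3.1 h3.2
  calc _ ≤ 1 * max |c₁| |c₂| := by gcongr
    _ = _ := one_mul _

theorem aestronglyMeasurable_angularInt (hφ : Integrable φ (phaseMeasure Ω)) :
    AEStronglyMeasurable (angularInt φ) (volume.restrict Ω) :=
  hφ.1.integral_prod_right'

theorem ae_integrable_angular (hφ : Integrable φ (phaseMeasure Ω)) :
    ∀ᵐ x ∂(volume.restrict Ω), Integrable (fun θ => φ (x, θ)) (angularMeasure d) :=
  hφ.prod_right_ae

theorem angularInt_le (hφ : Integrable φ (phaseMeasure Ω)) (hψ : Integrable ψ (phaseMeasure Ω))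
    (h : ∀ᵐ z ∂(phaseMeasure Ω), φ z ≤ ψ z) :
    ∀ᵐ x ∂(volume.restrict Ω), angularInt φ x ≤ angularInt ψ x := by
  filter_upwards [ae_integrable_angular hφ, ae_integrable_angular hψ,
    Measure.ae_ae_of_ae_prod h] with x h1 h2 h3
  exact integral_mono_ae h1 h2 h3

theorem angularInt_pos (hd : 0 < d) (hφ : Integrable φ (phaseMeasure Ω))
    (h : ∀ᵐ z ∂(phaseMeasure Ω), 0 < φ z) :
    ∀ᵐ x ∂(volume.restrict Ω), 0 < angularInt φ x := by
  filter_upwards [ae_integrable_angular hφ, Measure.ae_ae_of_ae_prod h] with x h1 h2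
  unfold angularInt
  rw [integral_pos_iff_support_of_nonneg_ae (h2.mono fun θ hθ => hθ.le) h1]
  have h3 : (angularMeasure d) (Function.support fun θ => φ (x, θ)) = (angularMeasure d) univ := by
    refine measure_congr ?_
    filter_upwards [h2] with θ hθ
    exact propext (iff_of_true hθ.ne' trivial)
  rw [h3]
  exact Measure.measure_univ_pos.2 (angularMeasure_ne_zero hd)

theorem angularInt_lt (hd : 0 < d) (hφ : Integrable φ (phaseMeasure Ω))
    (hψ : Integrable ψ (phaseMeasure Ω)) (h : ∀ᵐ z ∂(phaseMeasure Ω), φ z < ψ z) :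
    ∀ᵐ x ∂(volume.restrict Ω), angularInt φ x < angularInt ψ x := by
  filter_upwards [angularInt_pos hd (hψ.sub hφ) (h.mono fun z hz => sub_pos.2 hz),
    ae_integrable_angular hφ, ae_integrable_angular hψ] with x h1 h2 h3
  have : angularInt (ψ - φ) x = angularInt ψ x - angularInt φ x := integral_sub h3 h2
  linarith

end Angular

/-! ### The squeeze iteration -/

section Squeeze

variable {M : Medium d} {p : ℝ≥0∞} {c₁ c₂ : ℝ} {μ μ₁ μ₂ : Space d → ℝ}
  {φx φm φx₁ φx₂ φm₁ φm₂ : Space d × Dir d → ℝ}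

theorem IsCoeff.lower_zero {Ω : Set (Space d)} (h : IsCoeff Ω c₁ c₂ μ) (hc : 0 < c₁) :
    IsCoeff Ω 0 c₂ μ :=
  ⟨h.aestronglyMeasurable, h.bounds.mono fun _ hx => ⟨hc.le.trans hx.1, hx.2⟩⟩

theorem IsCoeff.add {Ω : Set (Space d)} (h₁ : IsCoeff Ω c₁ c₂ μ₁) (h₂ : IsCoeff Ω c₁ c₂ μ₂) :
    IsCoeff Ω (c₁ + c₁) (c₂ + c₂) fun x => μ₁ x + μ₂ x := by
  refine ⟨h₁.aestronglyMeasurable.add h₂.aestronglyMeasurable, ?_⟩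
  filter_upwards [h₁.bounds, h₂.bounds] with x h3 h4
  exact ⟨add_le_add h3.1 h4.1, add_le_add h3.2 h4.2⟩

theorem Medium.Admissible.exists_isExcitation (hM : M.Admissible p c₁ c₂) (hp : 1 ≤ p)
    (hμ : IsCoeff M.Ω c₁ c₂ μ) : ∃ φx, M.IsExcitation p μ φx :=
  exists_isRTESolution hM.isOpen hM.isBounded hM.convex hM.kernel hp (hM.μaxi.add hμ)
    (hM.μsx.lower_zero hM.c₁_pos) (add_pos hM.c₁_pos hM.c₁_pos) MemLp.zero'
    (ae_of_all _ fun _ => le_rfl) hM.qb_memLp (hM.qb_pos.mono fun _ hz => hz.le)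

theorem Medium.Admissible.excitation_pos (hM : M.Admissible p c₁ c₂) (hp : 1 ≤ p)
    (hμ : IsCoeff M.Ω c₁ c₂ μ) (h : M.IsExcitation p μ φx) :
    ∀ᵐ z ∂(phaseMeasure M.Ω), 0 < φx z :=
  (IsRTESolution.nonneg h hM.isOpen hM.isBounded hM.convex hM.kernel hp (hM.μaxi.add hμ)
    (hM.μsx.lower_zero hM.c₁_pos) (add_pos hM.c₁_pos hM.c₁_pos) (integrable_zero _ _ _)
    (ae_of_all _ fun _ => le_rfl) (hM.qb_pos.mono fun _ hz => hz.le)).2 hM.qb_pos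

/-- The comparison source is `(μ₂ - μ₁) φx₂`, whose sign is that of `μ₂ - μ₁` because `φx₂ > 0`. -/
theorem Medium.Admissible.excitation_le_and_lt (hM : M.Admissible p c₁ c₂) (hp : 1 ≤ p)
    (hμ₁ : IsCoeff M.Ω c₁ c₂ μ₁) (hμ₂ : IsCoeff M.Ω c₁ c₂ μ₂)
    (h₁ : M.IsExcitation p μ₁ φx₁) (h₂ : M.IsExcitation p μ₂ φx₂)
    (hle : ∀ᵐ x ∂(volume.restrict M.Ω), μ₁ x ≤ μ₂ x) :
    (∀ᵐ z ∂(phaseMeasure M.Ω), φx₂ z ≤ φx₁ z) ∧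
      ((∀ᵐ x ∂(volume.restrict M.Ω), μ₁ x < μ₂ x) →
        ∀ᵐ z ∂(phaseMeasure M.Ω), φx₂ z < φx₁ z) := by
  have hpos := hM.excitation_pos hp hμ₂ h₂
  have key := IsRTESolution.le_and_lt h₁ h₂ hM.isOpen hM.isBounded hM.convex hM.kernel hp
    (hM.μaxi.add hμ₁) (hM.μaxi.add hμ₂) (hM.μsx.lower_zero hM.c₁_pos)
    (add_pos hM.c₁_pos hM.c₁_pos) (integrable_zero _ _ _) (integrable_zero _ _ _) (by
      filter_upwards [hpos, ae_phaseMeasure_of_ae hle] with z h3 h4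
      have := mul_nonneg (sub_nonneg.2 h4) h3.le
      linarith)
  refine ⟨key.1, fun hlt => key.2 ?_⟩
  filter_upwards [hpos, ae_phaseMeasure_of_ae hlt] with z h3 h4
  have := mul_pos (sub_pos.2 h4) h3
  linarith

theorem angularMean_nonneg {Ω : Set (Space d)} (h : ∀ᵐ z ∂(phaseMeasure Ω), 0 ≤ φx z) :
    ∀ᵐ x ∂(volume.restrict Ω), 0 ≤ angularMean φx x := by
  filter_upwards [Measure.ae_ae_of_ae_prod h] with x hx
  exact mul_nonneg (by positivity) (integral_nonneg_of_ae hx)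

theorem Medium.Admissible.exists_isEmission (hM : M.Admissible p c₁ c₂) (hd : 0 < d) (hp : 1 ≤ p)
    (hμ : IsCoeff M.Ω c₁ c₂ μ) (hφ : MemLp φx p (phaseMeasure M.Ω))
    (hφ0 : ∀ᵐ z ∂(phaseMeasure M.Ω), 0 ≤ φx z) : ∃ φm, M.IsEmission p μ φx φm := by
  refine exists_isRTESolution hM.isOpen hM.isBounded hM.convex hM.kernel hp hM.μam
    (hM.μsm.lower_zero hM.c₁_pos) hM.c₁_pos
    (memLp_emission_source hd hp hM.η_meas hM.η_bounds hμ hφ) ?_ MemLp.zero'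
    (ae_of_all _ fun _ => le_rfl)
  filter_upwards [ae_phaseMeasure_of_ae hM.η_bounds, hμ.bounds_phase,
    ae_phaseMeasure_of_ae (angularMean_nonneg hφ0)] with z h1 h2 h3
  exact mul_nonneg (mul_nonneg h1.1 (hM.c₁_pos.le.trans h2.1)) h3

/-- Both equations have the same coefficients, so only the sources are compared. Strictness needs a
positive mean of `φx₁`, besides `η > 0` and `μ₁ < μ₂`. -/
theorem Medium.Admissible.emission_le_and_lt (hM : M.Admissible p c₁ c₂) (hd : 0 < d)
    (hp : 1 ≤ p) (hμ₁ : IsCoeff M.Ω c₁ c₂ μ₁) (hμ₂ : IsCoeff M.Ω c₁ c₂ μ₂)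
    (hφ₁ : MemLp φx₁ p (phaseMeasure M.Ω)) (hφ₂ : MemLp φx₂ p (phaseMeasure M.Ω))
    (h₁ : M.IsEmission p μ₁ φx₁ φm₁) (h₂ : M.IsEmission p μ₂ φx₂ φm₂)
    (hμle : ∀ᵐ x ∂(volume.restrict M.Ω), μ₁ x ≤ μ₂ x)
    (hφle : ∀ᵐ z ∂(phaseMeasure M.Ω), φx₁ z ≤ φx₂ z)
    (hφ0 : ∀ᵐ z ∂(phaseMeasure M.Ω), 0 < φx₁ z) :
    (∀ᵐ z ∂(phaseMeasure M.Ω), φm₁ z ≤ φm₂ z) ∧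
      ((∀ᵐ x ∂(volume.restrict M.Ω), μ₁ x < μ₂ x) → (∀ᵐ x ∂(volume.restrict M.Ω), 0 < M.η x) →
        ∀ᵐ z ∂(phaseMeasure M.Ω), φm₁ z < φm₂ z) := by
  have := isFiniteMeasure_phaseMeasure hM.isBounded
  have hS : 0 < ((angularMeasure d).real univ)⁻¹ := by
    have : NeZero (angularMeasure d) := ⟨angularMeasure_ne_zero hd⟩
    exact inv_pos.2 measureReal_univ_pos
  have hi₁ := hφ₁.integrable hp
  have hi₂ := hφ₂.integrable hp
  have hmean : ∀ᵐ x ∂(volume.restrict M.Ω),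
      0 < angularMean φx₁ x ∧ angularMean φx₁ x ≤ angularMean φx₂ x := by
    filter_upwards [angularInt_pos hd hi₁ hφ0, angularInt_le hi₁ hi₂ hφle] with x h3 h4
    exact ⟨mul_pos hS h3, mul_le_mul_of_nonneg_left h4 hS.le⟩
  have key := IsRTESolution.le_and_lt h₂ h₁ hM.isOpen hM.isBounded hM.convex hM.kernel hp
    hM.μam hM.μam (hM.μsm.lower_zero hM.c₁_pos) hM.c₁_pos
    ((memLp_emission_source hd hp hM.η_meas hM.η_bounds hμ₂ hφ₂).integrable hp)
    ((memLp_emission_source hd hp hM.η_meas hM.η_bounds hμ₁ hφ₁).integrable hp) (by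
      filter_upwards [ae_phaseMeasure_of_ae hM.η_bounds, hμ₁.bounds_phase,
        ae_phaseMeasure_of_ae hμle, ae_phaseMeasure_of_ae hmean] with z h3 h4 h5 h6
      rw [sub_self, zero_mul, add_zero, sub_nonneg]
      have h7 : 0 < μ₁ z.1 := hM.c₁_pos.trans_le h4.1
      have h8 := h3.1
      have h9 := h6.1
      gcongr
      · exact mul_nonneg h8 (h7.le.trans h5)
      · exact h6.2)
  refine ⟨key.1, fun hlt hη => key.2 ?_⟩
  filter_upwards [ae_phaseMeasure_of_ae hη, hμ₁.bounds_phase,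
    ae_phaseMeasure_of_ae hlt, ae_phaseMeasure_of_ae hmean] with z h3 h4 h5 h6
  rw [sub_self, zero_mul, add_zero, sub_pos]
  have h7 : 0 < μ₁ z.1 := hM.c₁_pos.trans_le h4.1
  calc M.η z.1 * μ₁ z.1 * angularMean φx₁ z.1
      < M.η z.1 * μ₂ z.1 * angularMean φx₁ z.1 := by
        have := h6.1
        gcongr
    _ ≤ _ := by
        gcongr
        · exact mul_nonneg h3.le (h7.le.trans h5.le)
        · exact h6.2

/-- Lower and upper bounds for the absorption coefficient `μ`. -/
structure IsBracket (Ω : Set (Space d)) (c₁ c₂ : ℝ) (μ μlo μhi : Space d → ℝ) : Prop where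
  lo : IsCoeff Ω c₁ c₂ μlo
  hi : IsCoeff Ω c₁ c₂ μhi
  lo_le : ∀ᵐ x ∂(volume.restrict Ω), μlo x ≤ μ x
  lt_hi : ∀ᵐ x ∂(volume.restrict Ω), μ x < μhi x

/-- The fields at one stage of the squeeze iteration. -/
structure Medium.IsStage (M : Medium d) (p : ℝ≥0∞) (μlo μhi : Space d → ℝ)
    (φxlo φxhi φmlo φmhi : Space d × Dir d → ℝ) : Prop where
  excitation_lo : M.IsExcitation p μlo φxlo
  excitation_hi : M.IsExcitation p μhi φxhi
  emission_hi : M.IsEmission p μhi φxlo φmhi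
  emission_lo : M.IsEmission p μlo φxhi φmlo

variable {μlo μhi μlo' μhi' : Space d → ℝ}
  {φxlo φxhi φmlo φmhi φxlo' φxhi' φmlo' φmhi' : Space d × Dir d → ℝ}

theorem Medium.Admissible.exists_isStage (hM : M.Admissible p c₁ c₂) (hd : 0 < d) (hp : 1 ≤ p)
    (hlo : IsCoeff M.Ω c₁ c₂ μlo) (hhi : IsCoeff M.Ω c₁ c₂ μhi) :
    ∃ φxlo φxhi φmlo φmhi, M.IsStage p μlo μhi φxlo φxhi φmlo φmhi := by
  obtain ⟨φxlo, h1⟩ := hM.exists_isExcitation hp hlo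
  obtain ⟨φxhi, h2⟩ := hM.exists_isExcitation hp hhi
  obtain ⟨φmhi, h3⟩ := hM.exists_isEmission hd hp hhi h1.memLp
    ((hM.excitation_pos hp hlo h1).mono fun _ hz => hz.le)
  obtain ⟨φmlo, h4⟩ := hM.exists_isEmission hd hp hlo h2.memLp
    ((hM.excitation_pos hp hhi h2).mono fun _ hz => hz.le)
  exact ⟨φxlo, φxhi, φmlo, φmhi, h1, h2, h3, h4⟩

/-- Monotonicity of the stages of the squeeze iteration in the absorption bounds. -/
theorem Medium.IsStage.mono (hM : M.Admissible p c₁ c₂) (hd : 0 < d) (hp : 1 ≤ p)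
    (hlo : IsCoeff M.Ω c₁ c₂ μlo) (hhi : IsCoeff M.Ω c₁ c₂ μhi)
    (hlo' : IsCoeff M.Ω c₁ c₂ μlo') (hhi' : IsCoeff M.Ω c₁ c₂ μhi')
    (h : M.IsStage p μlo μhi φxlo φxhi φmlo φmhi)
    (h' : M.IsStage p μlo' μhi' φxlo' φxhi' φmlo' φmhi')
    (hle : ∀ᵐ x ∂(volume.restrict M.Ω), μlo x ≤ μlo' x)
    (hge : ∀ᵐ x ∂(volume.restrict M.Ω), μhi' x ≤ μhi x) :
    (∀ᵐ z ∂(phaseMeasure M.Ω), φxlo' z ≤ φxlo z) ∧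
    (∀ᵐ z ∂(phaseMeasure M.Ω), φxhi z ≤ φxhi' z) ∧
    (∀ᵐ z ∂(phaseMeasure M.Ω), φmlo z ≤ φmlo' z) ∧
    (∀ᵐ z ∂(phaseMeasure M.Ω), φmhi' z ≤ φmhi z) := by
  have h1 := (hM.excitation_le_and_lt hp hlo hlo' h.excitation_lo h'.excitation_lo hle).1
  have h2 := (hM.excitation_le_and_lt hp hhi' hhi h'.excitation_hi h.excitation_hi hge).1
  refine ⟨h1, h2, ?_, ?_⟩
  -- The crossed pairing pays off here: `μlo` goes with `φxhi`, so both factors of the emission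
  -- source move in the same direction.
  · exact (hM.emission_le_and_lt hd hp hlo hlo' h.excitation_hi.memLp h'.excitation_hi.memLp
      h.emission_lo h'.emission_lo hle h2 (hM.excitation_pos hp hhi h.excitation_hi)).1
  · exact (hM.emission_le_and_lt hd hp hhi' hhi h'.excitation_lo.memLp h.excitation_lo.memLp
      h'.emission_hi h.emission_hi hge h1 (hM.excitation_pos hp hlo' h'.excitation_lo)).1

/-- The true fields lie between the fields of a bracketing stage. -/
theorem Medium.IsStage.bounds (hM : M.Admissible p c₁ c₂) (hd : 0 < d) (hp : 1 ≤ p)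
    (hμ : IsCoeff M.Ω c₁ c₂ μ) (hsol : M.IsSolution p μ φx φm)
    (hbr : IsBracket M.Ω c₁ c₂ μ μlo μhi) (h : M.IsStage p μlo μhi φxlo φxhi φmlo φmhi) :
    (∀ᵐ z ∂(phaseMeasure M.Ω), φx z ≤ φxlo z) ∧
    (∀ᵐ z ∂(phaseMeasure M.Ω), φxhi z < φx z) ∧
    (∀ᵐ z ∂(phaseMeasure M.Ω), φmlo z ≤ φm z) ∧
    (∀ᵐ z ∂(phaseMeasure M.Ω), φm z ≤ φmhi z) ∧
    ((∀ᵐ x ∂(volume.restrict M.Ω), 0 < M.η x) →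
      ∀ᵐ z ∂(phaseMeasure M.Ω), φm z < φmhi z) := by
  have hle := hbr.lt_hi.mono fun x hx => hx.le
  have h1 := (hM.excitation_le_and_lt hp hbr.lo hμ h.excitation_lo hsol.1 hbr.lo_le).1
  have h2 := (hM.excitation_le_and_lt hp hμ hbr.hi hsol.1 h.excitation_hi hle).2 hbr.lt_hi
  have h3 := hM.emission_le_and_lt hd hp hbr.lo hμ h.excitation_hi.memLp hsol.1.memLp
    h.emission_lo hsol.2 hbr.lo_le (h2.mono fun z hz => hz.le)
    (hM.excitation_pos hp hbr.hi h.excitation_hi)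
  have h4 := hM.emission_le_and_lt hd hp hμ hbr.hi hsol.1.memLp h.excitation_lo.memLp
    hsol.2 h.emission_hi hle h1 (hM.excitation_pos hp hμ hsol.1)
  exact ⟨h1, h2, h3.1, h4.1, h4.2 hbr.lt_hi⟩

/-- Overestimating the emission leaves a numerator of at most `(m + (1 - η) μ) A`, and `A ≤ Al`
bounds the quotient by `m + (1 - η) μ`. -/
theorem update_le_of_energy {η m a μ A Al B Bh : ℝ} (hη : η < 1) (hm : 0 < m) (hμ : 0 < μ)
    (ha : 0 < a) (hAl : 0 < Al) (hA : A ≤ Al) (hB : B ≤ Bh) :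
    1 / (1 - η) * (((m + (1 - η) * μ) * A + a * B - a * Bh) / Al - m) ≤ μ := by
  have h1 : 0 < 1 - η := by linarith
  have h2 : ((m + (1 - η) * μ) * A + a * B - a * Bh) / Al ≤ m + (1 - η) * μ := by
    rw [div_le_iff₀ hAl]
    have h3 := mul_le_mul_of_nonneg_left hA (add_pos hm (mul_pos h1 hμ)).le
    have h4 := mul_le_mul_of_nonneg_left hB ha.le
    linarith
  rw [one_div, inv_mul_le_iff₀ h1]
  linarith

theorem lt_update_of_energy {η m a μ A Ah B Bl : ℝ} (hη : η < 1) (hm : 0 < m) (hμ : 0 < μ)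
    (ha : 0 < a) (hAh : 0 < Ah) (hA : Ah < A) (hB : Bl ≤ B) :
    μ < 1 / (1 - η) * (((m + (1 - η) * μ) * A + a * B - a * Bl) / Ah - m) := by
  have h1 : 0 < 1 - η := by linarith
  have h2 : m + (1 - η) * μ < ((m + (1 - η) * μ) * A + a * B - a * Bl) / Ah := by
    rw [lt_div_iff₀ hAh]
    have h3 := mul_lt_mul_of_pos_left hA (add_pos hm (mul_pos h1 hμ))
    have h4 := mul_le_mul_of_nonneg_left hB ha.le
    linarith
  rw [one_div, lt_inv_mul_iff₀ h1]
  linarith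

theorem Medium.Admissible.aestronglyMeasurable_update (hM : M.Admissible p c₁ c₂) (hp : 1 ≤ p)
    (hμ : IsCoeff M.Ω c₁ c₂ μ) (hφx : MemLp φx p (phaseMeasure M.Ω))
    (hφm : MemLp φm p (phaseMeasure M.Ω)) (hφx₁ : MemLp φx₁ p (phaseMeasure M.Ω))
    (hφm₁ : MemLp φm₁ p (phaseMeasure M.Ω)) :
    AEStronglyMeasurable (M.update (M.energy μ φx φm) φx₁ φm₁) (volume.restrict M.Ω) := by
  have := isFiniteMeasure_phaseMeasure hM.isBounded
  have h1 := (aestronglyMeasurable_angularInt (hφx.integrable hp)).aemeasurable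
  have h2 := (aestronglyMeasurable_angularInt (hφm.integrable hp)).aemeasurable
  have h3 := (aestronglyMeasurable_angularInt (hφx₁.integrable hp)).aemeasurable
  have h4 := (aestronglyMeasurable_angularInt (hφm₁.integrable hp)).aemeasurable
  have h5 := hM.μaxi.aestronglyMeasurable.aemeasurable
  have h6 := hM.μam.aestronglyMeasurable.aemeasurable
  have h7 := hM.η_meas.aemeasurable
  have h8 := hμ.aestronglyMeasurable.aemeasurable
  refine AEMeasurable.aestronglyMeasurable ?_
  unfold Medium.update Medium.energy
  fun_prop

/-- One step of the squeeze iteration tightens a bracket. -/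
theorem IsBracket.succ (hM : M.Admissible p c₁ c₂) (hd : 0 < d) (hp : 1 ≤ p)
    (hμ : IsCoeff M.Ω c₁ c₂ μ) (hsol : M.IsSolution p μ φx φm)
    (hbr : IsBracket M.Ω c₁ c₂ μ μlo μhi) (h : M.IsStage p μlo μhi φxlo φxhi φmlo φmhi)
    (hlo' : ∀ᵐ x ∂(volume.restrict M.Ω),
      μlo' x = max (μlo x) (M.update (M.energy μ φx φm) φxlo φmhi x))
    (hhi' : ∀ᵐ x ∂(volume.restrict M.Ω),
      μhi' x = min (μhi x) (M.update (M.energy μ φx φm) φxhi φmlo x)) :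
    IsBracket M.Ω c₁ c₂ μ μlo' μhi' := by
  have := isFiniteMeasure_phaseMeasure hM.isBounded
  obtain ⟨h1, h2, h3, h4, -⟩ := h.bounds hM hd hp hμ hsol hbr
  have iφx := hsol.1.memLp.integrable hp
  have iφm := hsol.2.memLp.integrable hp
  have hle : ∀ᵐ x ∂(volume.restrict M.Ω), μlo' x ≤ μ x := by
    filter_upwards [hlo', hbr.lo_le, hM.η_bounds, hM.μaxi.bounds, hM.μam.bounds, hμ.bounds,
      angularInt_pos hd (h.excitation_lo.memLp.integrable hp)
        (hM.excitation_pos hp hbr.lo h.excitation_lo),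
      angularInt_le iφx (h.excitation_lo.memLp.integrable hp) h1,
      angularInt_le iφm (h.emission_hi.memLp.integrable hp) h4] with x e1 e2 e3 e4 e5 e6 e7 e8 e9
    rw [e1]
    exact max_le e2 (update_le_of_energy e3.2 (hM.c₁_pos.trans_le e4.1)
      (hM.c₁_pos.trans_le e6.1) (hM.c₁_pos.trans_le e5.1) e7 e8 e9)
  -- Strictness rests on `φxhi < φx`, hence on the strict upper bound of the previous stage; the
  -- emission bound may stay weak.
  have hlt : ∀ᵐ x ∂(volume.restrict M.Ω), μ x < μhi' x := by
    filter_upwards [hhi', hbr.lt_hi, hM.η_bounds, hM.μaxi.bounds, hM.μam.bounds, hμ.bounds,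
      angularInt_pos hd (h.excitation_hi.memLp.integrable hp)
        (hM.excitation_pos hp hbr.hi h.excitation_hi),
      angularInt_lt hd (h.excitation_hi.memLp.integrable hp) iφx h2,
      angularInt_le (h.emission_lo.memLp.integrable hp) iφm h3] with x e1 e2 e3 e4 e5 e6 e7 e8 e9
    rw [e1]
    exact lt_min e2 (lt_update_of_energy e3.2 (hM.c₁_pos.trans_le e4.1)
      (hM.c₁_pos.trans_le e6.1) (hM.c₁_pos.trans_le e5.1) e7 e8 e9)
  refine ⟨⟨?_, ?_⟩, ⟨?_, ?_⟩, hle, hlt⟩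
  · exact (hbr.lo.aestronglyMeasurable.sup (hM.aestronglyMeasurable_update hp hμ hsol.1.memLp
      hsol.2.memLp h.excitation_lo.memLp h.emission_hi.memLp)).congr
      (hlo'.mono fun x hx => hx.symm)
  -- The raw update has no a priori bounds: the maximum with the old iterate gives `c₁`, and the
  -- bracket around `μ` gives `c₂`.
  · filter_upwards [hle, hlo', hbr.lo.bounds, hμ.bounds] with x e1 e2 e3 e4
    exact ⟨e3.1.trans (e2 ▸ le_max_left _ _), e1.trans e4.2⟩
  · exact (hbr.hi.aestronglyMeasurable.inf (hM.aestronglyMeasurable_update hp hμ hsol.1.memLp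
      hsol.2.memLp h.excitation_hi.memLp h.emission_lo.memLp)).congr
      (hhi'.mono fun x hx => hx.symm)
  · filter_upwards [hlt, hhi', hbr.hi.bounds, hμ.bounds] with x e1 e2 e3 e4
    exact ⟨e4.1.trans e1.le, (e2 ▸ min_le_left _ _ : μhi' x ≤ μhi x).trans e3.2⟩

theorem IsBracket.of_eq_const {Ω : Set (Space d)}
    (hlt : ∀ᵐ x ∂(volume.restrict Ω), c₁ < μ x ∧ μ x < c₂)
    (hlo : ∀ᵐ x ∂(volume.restrict Ω), μlo x = c₁) (hhi : ∀ᵐ x ∂(volume.restrict Ω), μhi x = c₂) :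
    IsBracket Ω c₁ c₂ μ μlo μhi := by
  refine ⟨⟨(aestronglyMeasurable_const (b := c₁)).congr (hlo.mono fun x hx => hx.symm), ?_⟩,
    ⟨(aestronglyMeasurable_const (b := c₂)).congr (hhi.mono fun x hx => hx.symm), ?_⟩, ?_, ?_⟩
  · filter_upwards [hlt, hlo] with x h1 h2
    rw [h2]
    exact ⟨le_rfl, (h1.1.trans h1.2).le⟩
  · filter_upwards [hlt, hhi] with x h1 h2
    rw [h2]
    exact ⟨(h1.1.trans h1.2).le, le_rfl⟩
  · filter_upwards [hlt, hlo] with x h1 h2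
    rw [h2]
    exact h1.1.le
  · filter_upwards [hlt, hhi] with x h1 h2
    rw [h2]
    exact h1.2

theorem Medium.IsSIM.isStage {h : Space d → ℝ} {s : Iterates d} (hs : M.IsSIM p c₁ c₂ h s)
    (i : ℕ) : M.IsStage p (s.μlo i) (s.μhi i) (s.φxlo i) (s.φxhi i) (s.φmlo i) (s.φmhi i) :=
  ⟨hs.excitation_lo i, hs.excitation_hi i, hs.emission_hi i, hs.emission_lo i⟩

theorem Medium.IsSIM.isBracket (hM : M.Admissible p c₁ c₂) (hd : 0 < d) (hp : 1 ≤ p)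
    (hμ : IsCoeff M.Ω c₁ c₂ μ) (hlt : ∀ᵐ x ∂(volume.restrict M.Ω), c₁ < μ x ∧ μ x < c₂)
    (hsol : M.IsSolution p μ φx φm) {s : Iterates d}
    (hs : M.IsSIM p c₁ c₂ (M.energy μ φx φm) s) (i : ℕ) :
    IsBracket M.Ω c₁ c₂ μ (s.μlo i) (s.μhi i) := by
  induction i with
  | zero => exact .of_eq_const hlt hs.lo_zero hs.hi_zero
  | succ i ih => exact ih.succ hM hd hp hμ hsol (hs.isStage i) (hs.lo_succ i) (hs.hi_succ i)

/-- The six functions at one stage of the squeeze iteration. -/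
structure Stage (d : ℕ) where
  μlo : Space d → ℝ
  μhi : Space d → ℝ
  φxlo : Space d × Dir d → ℝ
  φxhi : Space d × Dir d → ℝ
  φmlo : Space d × Dir d → ℝ
  φmhi : Space d × Dir d → ℝ

theorem Medium.Admissible.exists_isSIM (hM : M.Admissible p c₁ c₂) (hd : 0 < d) (hp : 1 ≤ p)
    (hμ : IsCoeff M.Ω c₁ c₂ μ) (hlt : ∀ᵐ x ∂(volume.restrict M.Ω), c₁ < μ x ∧ μ x < c₂)
    (hsol : M.IsSolution p μ φx φm) : ∃ s, M.IsSIM p c₁ c₂ (M.energy μ φx φm) s := by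
  -- The bracket is carried through the recursion because it supplies the coefficient bounds under
  -- which the next stage is solvable.
  let P : Stage d → Prop := fun s => IsBracket M.Ω c₁ c₂ μ s.μlo s.μhi ∧
    M.IsStage p s.μlo s.μhi s.φxlo s.φxhi s.φmlo s.φmhi
  have hzero : ∃ s : {s // P s}, (s.1.μlo = fun _ => c₁) ∧ s.1.μhi = fun _ => c₂ := by
    have hbr : IsBracket M.Ω c₁ c₂ μ (fun _ => c₁) (fun _ => c₂) :=
      .of_eq_const hlt (ae_of_all _ fun _ => rfl) (ae_of_all _ fun _ => rfl)
    obtain ⟨φxlo, φxhi, φmlo, φmhi, hst⟩ := hM.exists_isStage hd hp hbr.lo hbr.hi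
    exact ⟨⟨⟨_, _, φxlo, φxhi, φmlo, φmhi⟩, hbr, hst⟩, rfl, rfl⟩
  have hnext : ∀ s : {s // P s}, ∃ s' : {s // P s},
      (s'.1.μlo = fun x => max (s.1.μlo x) (M.update (M.energy μ φx φm) s.1.φxlo s.1.φmhi x)) ∧
      (s'.1.μhi = fun x => min (s.1.μhi x) (M.update (M.energy μ φx φm) s.1.φxhi s.1.φmlo x)) := by
    rintro ⟨s, hbr, hst⟩
    have hbr' := hbr.succ hM hd hp hμ hsol hst (ae_of_all _ fun _ => rfl)
      (ae_of_all _ fun _ => rfl)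
    obtain ⟨φxlo, φxhi, φmlo, φmhi, hst'⟩ := hM.exists_isStage hd hp hbr'.lo hbr'.hi
    exact ⟨⟨⟨_, _, φxlo, φxhi, φmlo, φmhi⟩, hbr', hst'⟩, rfl, rfl⟩
  obtain ⟨s₀, hlo₀, hhi₀⟩ := hzero
  choose next hlo hhi using hnext
  let S : ℕ → {s // P s} := fun n => Nat.rec s₀ (fun _ s => next s) n
  refine ⟨⟨fun i => (S i).1.μlo, fun i => (S i).1.μhi, fun i => (S i).1.φxlo,
    fun i => (S i).1.φxhi, fun i => (S i).1.φmlo, fun i => (S i).1.φmhi⟩, ?_⟩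
  exact
    { lo_zero := ae_of_all _ fun x => congrFun hlo₀ x
      hi_zero := ae_of_all _ fun x => congrFun hhi₀ x
      excitation_lo := fun i => (S i).2.2.excitation_lo
      excitation_hi := fun i => (S i).2.2.excitation_hi
      emission_hi := fun i => (S i).2.2.emission_hi
      emission_lo := fun i => (S i).2.2.emission_lo
      lo_succ := fun i => ae_of_all _ fun x => congrFun (hlo (S i)) x
      hi_succ := fun i => ae_of_all _ fun x => congrFun (hhi (S i)) x }

end Squeeze

end FPAT

end

/-- All solutions and all runs are covered, so no choice of representatives matters. Comparisons
with the true fields at stage `i + 1` are the instance of the claim at `i + 1`. -/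
theorem theorem3 {d : ℕ} (hd : d = 2 ∨ d = 3) (M : FPAT.Medium d) (p : ℝ≥0∞) (hp : 1 ≤ p)
    (c₁ c₂ : ℝ) (hM : M.Admissible p c₁ c₂) (μ : FPAT.Space d → ℝ)
    (hμ : FPAT.IsCoeff M.Ω c₁ c₂ μ)
    (hlt : ∀ᵐ x ∂(volume.restrict M.Ω), c₁ < μ x ∧ μ x < c₂) :
    (∃ φx φm, M.IsSolution p μ φx φm) ∧
    ∀ φx φm, M.IsSolution p μ φx φm →
      (∃ s, M.IsSIM p c₁ c₂ (M.energy μ φx φm) s) ∧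
      ∀ s, M.IsSIM p c₁ c₂ (M.energy μ φx φm) s →
        (∀ i, ∀ᵐ x ∂(volume.restrict M.Ω),
          s.μlo i x ≤ s.μlo (i + 1) x ∧ s.μlo i x ≤ μ x ∧
          μ x < s.μhi i x ∧ s.μhi (i + 1) x ≤ s.μhi i x) ∧
        (∀ i, ∀ᵐ z ∂(FPAT.phaseMeasure M.Ω),
          s.φxlo (i + 1) z ≤ s.φxlo i z ∧ φx z ≤ s.φxlo i z ∧
          s.φxhi i z ≤ φx z ∧ s.φxhi i z ≤ s.φxhi (i + 1) z) ∧
        (∀ i, ∀ᵐ z ∂(FPAT.phaseMeasure M.Ω),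
          s.φmlo i z ≤ s.φmlo (i + 1) z ∧ s.φmlo i z ≤ φm z ∧
          φm z ≤ s.φmhi i z ∧ s.φmhi (i + 1) z ≤ s.φmhi i z) ∧
        ((∀ᵐ x ∂(volume.restrict M.Ω), 0 < M.η x) →
          ∀ i, ∀ᵐ z ∂(FPAT.phaseMeasure M.Ω), φm z < s.φmhi i z) := by
  have hd0 : 0 < d := by omega
  constructor
  · obtain ⟨φx, h1⟩ := hM.exists_isExcitation hp hμ
    obtain ⟨φm, h2⟩ := hM.exists_isEmission hd0 hp hμ h1.memLp
      ((hM.excitation_pos hp hμ h1).mono fun _ hz => hz.le)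
    exact ⟨φx, φm, h1, h2⟩
  intro φx φm hsol
  refine ⟨hM.exists_isSIM hd0 hp hμ hlt hsol, fun s hs => ?_⟩
  have hbr := hs.isBracket hM hd0 hp hμ hlt hsol
  have hlo : ∀ i, ∀ᵐ x ∂(volume.restrict M.Ω), s.μlo i x ≤ s.μlo (i + 1) x := fun i =>
    (hs.lo_succ i).mono fun x hx => hx ▸ le_max_left _ _
  have hhi : ∀ i, ∀ᵐ x ∂(volume.restrict M.Ω), s.μhi (i + 1) x ≤ s.μhi i x := fun i =>
    (hs.hi_succ i).mono fun x hx => hx ▸ min_le_left _ _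
  have hmono := fun i => (hs.isStage i).mono hM hd0 hp (hbr i).lo (hbr i).hi (hbr (i + 1)).lo
    (hbr (i + 1)).hi (hs.isStage (i + 1)) (hlo i) (hhi i)
  have hbd := fun i => (hs.isStage i).bounds hM hd0 hp hμ hsol (hbr i)
  refine ⟨fun i => ?_, fun i => ?_, fun i => ?_, fun hη i => ?_⟩
  · filter_upwards [hlo i, (hbr i).lo_le, (hbr i).lt_hi, hhi i] with x h1 h2 h3 h4
    exact ⟨h1, h2, h3, h4⟩
  · obtain ⟨h1, h2, -, -⟩ := hmono i
    obtain ⟨h3, h4, -, -, -⟩ := hbd i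
    filter_upwards [h1, h2, h3, h4] with z e1 e2 e3 e4
    exact ⟨e1, e3, e4.le, e2⟩
  · obtain ⟨-, -, h1, h2⟩ := hmono i
    obtain ⟨-, -, h3, h4, -⟩ := hbd i
    filter_upwards [h1, h2, h3, h4] with z e1 e2 e3 e4
    exact ⟨e1, e3, e4, e2⟩
  · exact (hbd i).2.2.2.2 hη
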